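/- Let $n \ge k \ge 2$, let $\square^n=[-1,1]^n\subset\mathbb{R}^n$, and let $H$ be a local maximizer of the function $H\mapsto \mathrm{vol}_k(\square^n\cap H)$ on the Grassmannian $\mathrm{Gr}(n,k)$ of $k$-dimensional linear subspaces of $\mathbb{R}^n$ (with its usual topology, in which two subspaces are close when the orthogonal projections onto them are close). For $i\in[n]=\{1,\dots,n\}$ let $v_i$ be the orthogonal projection onto $H$ of the $i$-th vector of the standard basis of $\mathbb{R}^n$. Put $P=\square^n\cap H$, regarded as a $k$-dimensional polytope in $H$. Then: 1. $P=\bigcap_{i\in[n]}\{x\in H:\ |\langle x,v_i\rangle|\le 1\}$. 2. For every $i\in[n]$, $v_i\ne 0$ and the intersection $F_i$ of $P$ with the hyperplane $\{x\in H:\langle x,v_i\rangle=1\}$ is a facet of $P$. 3. For every $i\in[n]$, the line $\mathrm{span}\{v_i\}$ intersects the boundary of $P$ (relative to $H$) in centroids of facets of $P$: the line meets the boundary of $P$, each of its points on the boundary is the centroid of a facet of $P$, and its intersection with the facet $F_i$ is exactly the centroid of $F_i$. (The centroid of a facet is its center of mass with respect to $(k-1)$-dimensional volume.) 4. For every facet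 $F$ of $P$, with $P_F=\mathrm{co}\{0,F\}$ the convex hull of $F\cup\{0\}$, $$\frac{\mathrm{vol}_k\,P_F}{\mathrm{vol}_k\,P}=\frac12\cdot\frac{\sum_{\star}|v_i|^2}{k},$$ where the sum is over all $i\in[n]$ such that the line $\mathrm{span}\{v_i\}$ intersects $F$ in the centroid of $F$. -/

import Mathlib

open MeasureTheory

namespace CubeSection

/-- The cube `[-1, 1]^n` in Euclidean space. -/
def cube (n : ℕ) : Set (EuclideanSpace ℝ (Fin n)) :=
  {x | ∀ i, x i ∈ Set.Icc (-1 : ℝ) 1}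

/-- The Grassmannian of `k`-dimensional linear subspaces of `ℝ^n`. -/
def Gr (n k : ℕ) : Type :=
  {H : Submodule ℝ (EuclideanSpace ℝ (Fin n)) // Module.finrank ℝ H = k}

/-- The usual topology of the Grassmannian, in which two subspaces are close when
the orthogonal projections onto them are close in operator norm. -/
noncomputable instance (n k : ℕ) : TopologicalSpace (Gr n k) :=
  TopologicalSpace.induced (fun H => H.1.starProjection) inferInstance

/-- The section of the cube by `H`, as a subset of the Euclidean space `H`. -/
def cubeSection {n : ℕ} (H : Submodule ℝ (EuclideanSpace ℝ (Fin n))) : Set H :=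
  {x | (x : EuclideanSpace ℝ (Fin n)) ∈ cube n}

/-- The `d`-dimensional volume of a subset of a Euclidean space: the `d`-dimensional Hausdorff
measure, normalised to be Lebesgue measure on `ℝ^d`. -/
noncomputable def vol {E : Type*} [NormedAddCommGroup E] [InnerProductSpace ℝ E]
    [MeasurableSpace E] [BorelSpace E] (d : ℕ) (A : Set E) : ℝ :=
  (Measure.euclideanHausdorffMeasure d : Measure E).real A

/-- The function on the Grassmannian whose local maximizers are studied: the `k`-dimensional
volume of the section of the cube. -/
noncomputable def sectionVolume (n k : ℕ) (H : Gr n k) : ℝ :=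
  vol k (cubeSection H.1)

/-- The orthogonal projection of the `i`-th standard basis vector onto `H`. -/
noncomputable def projBasis {n : ℕ} (H : Submodule ℝ (EuclideanSpace ℝ (Fin n)))
    (i : Fin n) : H :=
  H.orthogonalProjectionOnto (EuclideanSpace.single i 1)

/-- The facets of a polytope `P`: its nonempty (exposed) faces of dimension `dim P - 1`. -/
def IsFacet {E : Type*} [NormedAddCommGroup E] [InnerProductSpace ℝ E] (P F : Set E) : Prop :=
  IsExposed ℝ P F ∧ F.Nonempty ∧
    Module.finrank ℝ (vectorSpan ℝ F) + 1 = Module.finrank ℝ (vectorSpan ℝ P)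

/-- The centroid of a set `F`: the mean of its points with respect to the volume in the
dimension `dim F` of its affine hull. -/
noncomputable def centroid {E : Type*} [NormedAddCommGroup E] [InnerProductSpace ℝ E]
    [MeasurableSpace E] [BorelSpace E] (F : Set E) : E :=
  ⨍ x in F, x ∂(Measure.euclideanHausdorffMeasure (Module.finrank ℝ (vectorSpan ℝ F)))

/-- The line (linear span) through `v`. -/
def line {E : Type*} [NormedAddCommGroup E] [InnerProductSpace ℝ E] (v : E) : Set E :=
  (Submodule.span ℝ {v} : Submodule ℝ E)

/-- The intersection of the section with the hyperplane `⟨x, v_i⟩ = 1` of `H`. -/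
def facetAt {n : ℕ} (H : Submodule ℝ (EuclideanSpace ℝ (Fin n))) (i : Fin n) : Set H :=
  cubeSection H ∩ {x | inner ℝ x (projBasis H i) = 1}

open Classical in
/-- The indices `i` for which the line spanned by `v_i` intersects `F` in the centroid of `F`. -/
noncomputable def centroidIndices {n : ℕ} (H : Submodule ℝ (EuclideanSpace ℝ (Fin n)))
    (F : Set H) : Finset (Fin n) :=
  {i | line (projBasis H i) ∩ F = {centroid F}}

end CubeSection

/-! The argument is a first-order variation. For a linear map `M : H → ℝ^n`, the range of `x ↦ x + t
M x` is a `k`-dimensional subspace near `H` for small `t`, so its section has volume at most that of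
`P` (`eventually_vol_pert_le`). Pulled back to `H`, this volume is a Jacobian times the volume of
`{x | ‖x + t M x‖_∞ ≤ 1}`, and the latter is `D(t)/k!` with `D(t) = ∫ exp(-‖x + t M x‖_∞)`
(`volume_supCoord_le_one`), which can be differentiated under the integral sign.

No `v_i` vanishes: otherwise tilting `H` towards `e_i` would enlarge the section
(`projBasis_ne_zero`). For `v = ± v_i`, let `m` be the number of indices `j` with `v_j = ± v`, and
take `M x = ⟪x, w⟫ s`, where `s` is the signed sum of the corresponding `e_j`. The Jacobian is at
least `1 + t m ⟪v, w⟫`, with equality at `t = 0`, so `(1 + t m ⟪v, w⟫) D(t)` has a local maximum at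
`0`. Its derivative vanishes there (`first_order_condition`), and polar coordinates on the cone over
the face `F` in `⟪x, v⟫ = 1` turn this into `∫_F ⟪x, w⟫ = (m/2) vol(P) |v| ⟪v, w⟫` for all `w`
(`integral_inner_faceOf`).

Everything follows from this identity. With `w = v` it gives the area of `F`, which is positive, so
`F` is a facet. With arbitrary `w` it gives the centroid `v/|v|²`, which lies on the line of `v`.
The cone over `F` has volume its area divided by `k|v|`, that is `m |v|² vol(P)/(2k)`. Finally,
every facet is such an `F` (`exists_eq_faceOf`), and the indices whose line meets `F` exactly in its
centroid are the `m` parallel ones (`centroidIndices_faceOf`). -/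

open scoped Topology InnerProductSpace
open Filter Module

namespace CubeSection

/-! ### Continuity of the projection onto the range of a linear map -/

section Projection

variable {U V : Type*} [NormedAddCommGroup U] [InnerProductSpace ℝ U] [FiniteDimensional ℝ U]
  [NormedAddCommGroup V] [InnerProductSpace ℝ V] [FiniteDimensional ℝ V]

/-- The map `L (L† L)⁻¹ L†`, which is the orthogonal projection onto the range of an injective
map `L`. -/
noncomputable def gramProjection (L : U →L[ℝ] V) : V →L[ℝ] V :=
  L ∘L (Ring.inverse (L.adjoint ∘L L : U →L[ℝ] U)) ∘L L.adjoint

lemma injective_of_isUnit_gram {L : U →L[ℝ] V} (h : IsUnit (L.adjoint ∘L L : U →L[ℝ] U)) :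
    Function.Injective L := by
  obtain ⟨u, hu⟩ := h
  have h1 : ∀ x, (↑u⁻¹ : U →L[ℝ] U) (L.adjoint (L x)) = x := fun x => by
    have := DFunLike.congr_fun u.inv_mul x
    rwa [hu] at this
  exact Function.LeftInverse.injective (g := fun y => (↑u⁻¹ : U →L[ℝ] U) (L.adjoint y)) h1

lemma starProjection_range_eq_gramProjection {L : U →L[ℝ] V}
    (h : IsUnit (L.adjoint ∘L L : U →L[ℝ] U)) :
    (L.toLinearMap.range).starProjection = gramProjection L := by
  ext1 y
  have h1 : ∀ z, L.adjoint (L (Ring.inverse (L.adjoint ∘L L : U →L[ℝ] U) z)) = z := fun z =>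
    DFunLike.congr_fun (Ring.mul_inverse_cancel _ h) z
  apply Submodule.eq_starProjection_of_mem_of_inner_eq_zero
  · exact ⟨_, rfl⟩
  · rintro _ ⟨x, rfl⟩
    change ⟪y - L (Ring.inverse (L.adjoint ∘L L : U →L[ℝ] U) (L.adjoint y)), L x⟫_ℝ = 0
    rw [← ContinuousLinearMap.adjoint_inner_left, map_sub, h1, sub_self, inner_zero_left]

/-- Inversion is continuous at units. This makes the perturbed subspaces converge in the topology of
the Grassmannian. -/
lemma continuousAt_gramProjection {L : ℝ → U →L[ℝ] V} (hL : ContinuousAt L 0)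
    (h : IsUnit ((L 0).adjoint ∘L L 0 : U →L[ℝ] U)) :
    ContinuousAt (fun t => gramProjection (L t)) 0 := by
  have hadj : ContinuousAt (fun t => (L t).adjoint) 0 :=
    (ContinuousLinearMap.adjoint (𝕜 := ℝ) (E := U) (F := V)).continuous.continuousAt.comp hL
  have hG : ContinuousAt (fun t => ((L t).adjoint ∘L L t : U →L[ℝ] U)) 0 := hadj.clm_comp hL
  obtain ⟨u, hu⟩ := h
  have hinv : ContinuousAt (fun t => Ring.inverse ((L t).adjoint ∘L L t : U →L[ℝ] U)) 0 := by
    apply ContinuousAt.comp (g := Ring.inverse) _ hG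
    rw [← hu]
    exact NormedRing.inverse_continuousAt u
  exact hL.clm_comp (hinv.clm_comp hadj)

end Projection

/-! ### Perturbed sections, and nonvanishing of the projections -/

section Perturbation

variable {n k : ℕ}

/-- The perturbed inclusion `x ↦ x + t • M x`. -/
noncomputable def pert {H : Submodule ℝ (EuclideanSpace ℝ (Fin n))}
    (M : H →L[ℝ] EuclideanSpace ℝ (Fin n)) (t : ℝ) : H →L[ℝ] EuclideanSpace ℝ (Fin n) :=
  H.subtypeL + t • M

lemma vol_image_subtype (K : Submodule ℝ (EuclideanSpace ℝ (Fin n))) (A : Set K) :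
    vol k (Subtype.val '' A) = vol k A := by
  unfold vol Measure.real
  rw [isometry_subtype_coe.euclideanHausdorffMeasure_image]

/-- The left side is the volume of the section by the range of `pert M t`; the ranges tend to `H`
because their orthogonal projections do. -/
lemma eventually_vol_pert_le (H : Gr n k) (hH : IsLocalMax (sectionVolume n k) H)
    (M : H.1 →L[ℝ] EuclideanSpace ℝ (Fin n)) :
    ∀ᶠ t in 𝓝 (0 : ℝ),
      vol k (pert M t '' {x | pert M t x ∈ cube n}) ≤ vol k (cubeSection H.1) := by
  have hc : Continuous (pert M) := by unfold pert; fun_prop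
  have hG : Continuous (fun t => ((pert M t).adjoint ∘L pert M t : H.1 →L[ℝ] H.1)) :=
    ((ContinuousLinearMap.adjoint (𝕜 := ℝ)).continuous.comp hc).clm_comp hc
  have h0 : ((pert M 0).adjoint ∘L pert M 0 : H.1 →L[ℝ] H.1) = 1 := by
    ext1 x
    apply ext_inner_right ℝ
    intro y
    simp [pert, ContinuousLinearMap.adjoint_inner_left]
  have hunit : IsUnit ((pert M 0).adjoint ∘L pert M 0 : H.1 →L[ℝ] H.1) := by
    rw [h0]; exact isUnit_one
  have hU : ∀ᶠ t in 𝓝 (0 : ℝ), IsUnit ((pert M t).adjoint ∘L pert M t : H.1 →L[ℝ] H.1) := by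
    have hopen : IsOpen {x : H.1 →L[ℝ] H.1 | IsUnit x} :=
      Units.isOpen (R := H.1 →L[ℝ] H.1)
    have hmem : ((pert M 0).adjoint ∘L pert M 0 : H.1 →L[ℝ] H.1) ∈ {x | IsUnit x} := hunit
    filter_upwards [hG.continuousAt.eventually_mem (hopen.mem_nhds hmem)] with t ht
    exact ht
  classical
  let K : ℝ → Gr n k := fun t =>
    if h : IsUnit ((pert M t).adjoint ∘L pert M t : H.1 →L[ℝ] H.1) then
      ⟨(pert M t).toLinearMap.range,
        (LinearMap.finrank_range_of_inj (injective_of_isUnit_gram h)).trans H.2⟩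
    else H
  have hK : ∀ t, IsUnit ((pert M t).adjoint ∘L pert M t : H.1 →L[ℝ] H.1) →
      (K t).1 = (pert M t).toLinearMap.range := fun t ht =>
    congrArg Subtype.val (dif_pos ht)
  have hproj : ∀ t, IsUnit ((pert M t).adjoint ∘L pert M t : H.1 →L[ℝ] H.1) →
      (K t).1.starProjection = gramProjection (pert M t) := fun t ht => by
    rw [← starProjection_range_eq_gramProjection ht]
    congr 1
    exact hK t ht
  have hrange0 : (pert M 0).toLinearMap.range = H.1 := by
    have : (pert M 0).toLinearMap = H.1.subtype := by ext1 x; simp [pert]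
    rw [this, Submodule.range_subtype]
  have hK0 : K 0 = H := Subtype.ext ((hK 0 hunit).trans hrange0)
  have hKt : Tendsto K (𝓝 0) (𝓝 H) := by
    rw [nhds_induced, tendsto_comap_iff]
    have h1 := continuousAt_gramProjection (L := pert M) hc.continuousAt hunit
    rw [ContinuousAt, ← hproj 0 hunit, hK0] at h1
    refine h1.congr' ?_
    filter_upwards [hU] with t ht
    exact (hproj t ht).symm
  filter_upwards [hU, hKt.eventually hH] with t ht hle
  refine le_trans (le_of_eq ?_) hle
  unfold sectionVolume
  rw [← vol_image_subtype]
  congr 1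
  ext y
  simp only [Set.mem_image, Set.mem_ofPred_eq, cubeSection]
  constructor
  · rintro ⟨x, hx, rfl⟩
    exact ⟨⟨pert M t x, by rw [hK t ht]; exact ⟨x, rfl⟩⟩, hx, rfl⟩
  · rintro ⟨⟨z, hz⟩, hzc, rfl⟩
    rw [hK t ht] at hz
    obtain ⟨x, rfl⟩ := hz
    exact ⟨x, hzc, rfl⟩

lemma vol_eq_volume {U : Type*} [NormedAddCommGroup U] [InnerProductSpace ℝ U]
    [FiniteDimensional ℝ U] [MeasurableSpace U] [BorelSpace U] (hU : finrank ℝ U = k)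
    (A : Set U) : vol k A = (volume : Measure U).real A := by
  unfold vol
  rw [← hU, InnerProductSpace.euclideanHausdorffMeasure_eq_volume]

lemma vol_image_linearMap {U V : Type*} [NormedAddCommGroup U] [InnerProductSpace ℝ U]
    [FiniteDimensional ℝ U] [MeasurableSpace U] [BorelSpace U]
    [NormedAddCommGroup V] [InnerProductSpace ℝ V] [MeasurableSpace V] [BorelSpace V]
    (hU : finrank ℝ U = k) (f : U →ₗ[ℝ] V) (A : Set U) :
    vol k (f '' A) = f.normDet * vol k A := by
  rw [vol_eq_volume hU]
  unfold vol Measure.real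
  rw [← hU, f.euclideanHausdorffMeasure_image_eq_normDet_mul_volume, ENNReal.toReal_mul,
    ENNReal.toReal_ofReal f.normDet_nonneg]

lemma inner_projBasis (H : Submodule ℝ (EuclideanSpace ℝ (Fin n))) (x : H) (i : Fin n) :
    ⟪x, projBasis H i⟫_ℝ = (x : EuclideanSpace ℝ (Fin n)) i := by
  unfold projBasis
  rw [Submodule.inner_orthogonalProjectionOnto_eq_of_mem_left]
  simp [EuclideanSpace.inner_single_right]

lemma mem_cubeSection {H : Submodule ℝ (EuclideanSpace ℝ (Fin n))} {x : H} :
    x ∈ cubeSection H ↔ ∀ i, |⟪x, projBasis H i⟫_ℝ| ≤ 1 := by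
  simp only [cubeSection, cube, Set.mem_ofPred_eq, inner_projBasis, Set.mem_Icc, abs_le]

/-- The maximal absolute value of a coordinate. -/
noncomputable def supCoord (x : EuclideanSpace ℝ (Fin n)) : ℝ := ‖WithLp.ofLp x‖

lemma mem_cube_iff {x : EuclideanSpace ℝ (Fin n)} : x ∈ cube n ↔ supCoord x ≤ 1 := by
  unfold supCoord cube
  rw [pi_norm_le_iff_of_nonneg zero_le_one]
  simp [abs_le]

lemma continuous_supCoord : Continuous (supCoord (n := n)) := by
  unfold supCoord; fun_prop

lemma supCoord_add_le (x y : EuclideanSpace ℝ (Fin n)) :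
    supCoord (x + y) ≤ supCoord x + supCoord y := norm_add_le _ _

lemma supCoord_sub_le (x y : EuclideanSpace ℝ (Fin n)) :
    |supCoord x - supCoord y| ≤ supCoord (x - y) := abs_norm_sub_norm_le _ _

lemma supCoord_smul (r : ℝ) (x : EuclideanSpace ℝ (Fin n)) :
    supCoord (r • x) = |r| * supCoord x := norm_smul _ _

lemma supCoord_nonneg (x : EuclideanSpace ℝ (Fin n)) : 0 ≤ supCoord x := norm_nonneg _

lemma abs_coord_le_supCoord (x : EuclideanSpace ℝ (Fin n)) (i : Fin n) : |x i| ≤ supCoord x :=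
  norm_le_pi_norm (WithLp.ofLp x) i

lemma supCoord_le_norm (x : EuclideanSpace ℝ (Fin n)) : supCoord x ≤ ‖x‖ := by
  unfold supCoord
  rw [pi_norm_le_iff_of_nonneg (norm_nonneg _)]
  exact fun i => PiLp.norm_apply_le x i

/-- Any constant would do; `n + 1` is positive even when `n = 0`. -/
lemma norm_le_mul_supCoord (x : EuclideanSpace ℝ (Fin n)) :
    ‖x‖ ≤ (n + 1) * supCoord x := by
  have h : ‖x‖ ^ 2 ≤ ((n + 1) * supCoord x) ^ 2 := by
    rw [EuclideanSpace.real_norm_sq_eq]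
    calc ∑ i, x i ^ 2 ≤ ∑ _i : Fin n, supCoord x ^ 2 :=
          Finset.sum_le_sum fun i _ => sq_le_sq' (abs_le.1 (abs_coord_le_supCoord x i)).1
            (abs_le.1 (abs_coord_le_supCoord x i)).2
      _ = n * supCoord x ^ 2 := by simp
      _ ≤ ((n + 1) * supCoord x) ^ 2 := by
          rw [mul_pow]
          gcongr
          nlinarith [(Nat.cast_nonneg n : (0 : ℝ) ≤ n)]
  exact le_of_sq_le_sq h (by have := supCoord_nonneg x; positivity)

lemma eq_zero_of_supCoord_eq_zero {x : EuclideanSpace ℝ (Fin n)} (h : supCoord x = 0) : x = 0 := by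
  have := norm_le_mul_supCoord x
  rw [h, mul_zero] at this
  exact norm_le_zero_iff.1 this

lemma isCompact_cubeSection (H : Submodule ℝ (EuclideanSpace ℝ (Fin n))) :
    IsCompact (cubeSection H) := by
  have h : cubeSection H = {x : H | supCoord (x : EuclideanSpace ℝ (Fin n)) ≤ 1} := by
    ext x; exact mem_cube_iff
  apply Metric.isCompact_of_isClosed_isBounded
  · rw [h]
    exact isClosed_le (continuous_supCoord.comp continuous_subtype_val) continuous_const
  · rw [isBounded_iff_forall_norm_le]
    refine ⟨n + 1, fun x hx => ?_⟩
    rw [h] at hx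
    have h1 := norm_le_mul_supCoord (x : EuclideanSpace ℝ (Fin n))
    have h2 : supCoord (x : EuclideanSpace ℝ (Fin n)) ≤ 1 := hx
    calc ‖x‖ = ‖(x : EuclideanSpace ℝ (Fin n))‖ := rfl
      _ ≤ (n + 1) * 1 := h1.trans (by gcongr)
      _ = n + 1 := mul_one _

lemma ball_subset_cubeSection (H : Submodule ℝ (EuclideanSpace ℝ (Fin n))) :
    Metric.ball 0 1 ⊆ cubeSection H := fun x hx => by
  change _ ∈ cube n
  rw [mem_cube_iff]
  exact (supCoord_le_norm _).trans (mem_ball_zero_iff.1 hx).le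

lemma vol_cubeSection_pos (H : Gr n k) : 0 < vol k (cubeSection H.1) := by
  rw [vol_eq_volume H.2]
  apply ENNReal.toReal_pos
  · exact ((Metric.measure_ball_pos volume (0 : H.1) one_pos).trans_le
      (measure_mono (ball_subset_cubeSection H.1))).ne'
  · exact (isCompact_cubeSection H.1).measure_lt_top.ne

/-- The rank-one map `x ↦ ⟪x, w⟫ e`. -/
noncomputable def rankOneMap {H : Submodule ℝ (EuclideanSpace ℝ (Fin n))} (w : H)
    (e : EuclideanSpace ℝ (Fin n)) : H →L[ℝ] EuclideanSpace ℝ (Fin n) :=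
  (innerSL ℝ w).smulRight e

@[simp] lemma pert_rankOneMap_apply {H : Submodule ℝ (EuclideanSpace ℝ (Fin n))} (w : H)
    (e : EuclideanSpace ℝ (Fin n)) (t : ℝ) (x : H) :
    pert (rankOneMap w e) t x = x + (t * ⟪x, w⟫_ℝ) • e := by
  simp [pert, rankOneMap, real_inner_comm, smul_smul]

/-- If `v_i = 0` then `H` is orthogonal to `e_i`. The tilt `x ↦ x + t ⟪x, w⟫ e_i` changes only the
`i`-th coordinate, so for small `t` it keeps all of `P` in the cube, while it multiplies volume by
`√(1 + t²|w|²) > 1`. -/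
lemma projBasis_ne_zero (hk : 2 ≤ k) (H : Gr n k) (hH : IsLocalMax (sectionVolume n k) H)
    (i : Fin n) : projBasis H.1 i ≠ 0 := by
  intro h0
  have hnt : Nontrivial H.1 := by
    apply Module.nontrivial_of_finrank_pos (R := ℝ); rw [H.2]; omega
  obtain ⟨w, hw⟩ := exists_ne (0 : H.1)
  set e : EuclideanSpace ℝ (Fin n) := EuclideanSpace.single i 1
  have hcoord : ∀ x : H.1, (x : EuclideanSpace ℝ (Fin n)) i = 0 := fun x => by
    rw [← inner_projBasis, h0, inner_zero_right]
  obtain ⟨R, hR⟩ := isBounded_iff_forall_norm_le.1 (isCompact_cubeSection H.1).isBounded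
  have hsmall : ∀ᶠ t in 𝓝 (0 : ℝ), |t| * (R * ‖w‖) < 1 := by
    have : Tendsto (fun t : ℝ => |t| * (R * ‖w‖)) (𝓝 0) (𝓝 (|0| * (R * ‖w‖))) :=
      (continuous_abs.mul continuous_const).tendsto 0
    rw [abs_zero, zero_mul] at this
    exact this.eventually (gt_mem_nhds one_pos)
  have hev := (eventually_vol_pert_le H hH (rankOneMap w e)).and hsmall
  obtain ⟨t, ⟨hle, hts⟩, ht0⟩ :=
    ((hev.filter_mono nhdsWithin_le_nhds).and (self_mem_nhdsWithin (s := {0}ᶜ))).exists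
  have ht0 : t ≠ 0 := ht0
  have hsub : cubeSection H.1 ⊆ {x | pert (rankOneMap w e) t x ∈ cube n} := by
    intro x hx j
    rw [pert_rankOneMap_apply]
    by_cases hj : j = i
    · subst hj
      have h1 : |t * ⟪x, w⟫_ℝ| ≤ 1 := by
        rw [abs_mul]
        refine le_trans ?_ hts.le
        gcongr
        exact (abs_real_inner_le_norm x w).trans (by gcongr; exact hR x hx)
      simpa [e, hcoord x] using abs_le.1 h1
    · simpa [e, hj] using hx j
  have hdet : 1 < (pert (rankOneMap w e) t).toLinearMap.normDet := by
    have h2 := (pert (rankOneMap w e) t).normDet_sq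
    -- Since `e ⟂ H`, the cross terms vanish and the Gram operator is the identity plus `t² ⟪·, w⟫
    -- w`.
    have h3 : ((pert (rankOneMap w e) t).adjoint ∘L pert (rankOneMap w e) t).toLinearMap
        = LinearMap.transvection (innerSL ℝ w).toLinearMap (t ^ 2 • w) := by
      ext1 x
      apply ext_inner_right ℝ
      intro y
      have hx := hcoord x
      have hy := hcoord y
      change ⟪(pert (rankOneMap w e) t).adjoint (pert (rankOneMap w e) t x), y⟫_ℝ = _
      rw [ContinuousLinearMap.adjoint_inner_left, pert_rankOneMap_apply, pert_rankOneMap_apply]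
      simp [LinearMap.transvection.apply, inner_add_left, inner_add_right, inner_smul_left,
        inner_smul_right, e, EuclideanSpace.inner_single_right, EuclideanSpace.inner_single_left,
        hx, hy, real_inner_comm]
      ring
    have h4 : ((pert (rankOneMap w e) t).adjoint ∘L pert (rankOneMap w e) t).det
        = 1 + t ^ 2 * ‖w‖ ^ 2 := by
      rw [ContinuousLinearMap.det, h3, LinearMap.transvection.det]
      simp
    rw [h4] at h2
    have h5 : 0 < t ^ 2 * ‖w‖ ^ 2 := by have := norm_pos_iff.2 hw; positivity
    have h6 : (1 : ℝ) < (pert (rankOneMap w e) t).toLinearMap.normDet ^ 2 := by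
      simp only [RCLike.ofReal_real_eq_id, id] at h2
      linarith
    exact (one_lt_sq_iff₀ (LinearMap.normDet_nonneg _)).1 h6
  have hvol := vol_cubeSection_pos H
  have hmono : vol k (pert (rankOneMap w e) t '' cubeSection H.1) ≤ vol k (cubeSection H.1) := by
    refine le_trans ?_ hle
    unfold vol
    refine measureReal_mono (Set.image_mono hsub) ?_
    -- Monotonicity of the real-valued measure needs the larger set to have finite measure.
    have h7 := (pert (rankOneMap w e) t).toLinearMap.euclideanHausdorffMeasure_image_eq_normDet_mul_volume
      {x | pert (rankOneMap w e) t x ∈ cube n}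
    rw [H.2] at h7
    refine ne_of_eq_of_ne h7 (ENNReal.mul_ne_top ENNReal.ofReal_ne_top ?_)
    refine ((measure_mono (t := cubeSection H.1) ?_).trans_lt
      (isCompact_cubeSection H.1).measure_lt_top).ne
    intro x hx j
    have := hx j
    rw [pert_rankOneMap_apply] at this
    by_cases hj : j = i
    · subst hj
      change (x : EuclideanSpace ℝ (Fin n)) j ∈ _
      rw [hcoord x]; simp
    · simpa [e, hj] using this
  have h8 := vol_image_linearMap H.2 (pert (rankOneMap w e) t).toLinearMap (cubeSection H.1)
  change vol k (pert (rankOneMap w e) t '' cubeSection H.1) = _ at h8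
  rw [h8] at hmono
  nlinarith

end Perturbation

/-! ### Polar coordinates on the cone over a subset of a hyperplane -/

section Cone

variable {U : Type*} [NormedAddCommGroup U] [InnerProductSpace ℝ U] [FiniteDimensional ℝ U]
  [MeasurableSpace U] [BorelSpace U]

/-- The open-ended cone over a subset `F` of the hyperplane `⟪x, v⟫ = 1`. -/
def coneOver (v : U) (F : Set U) : Set U := {x | 0 < ⟪x, v⟫_ℝ ∧ (⟪x, v⟫_ℝ)⁻¹ • x ∈ F}

lemma measurable_radial (v : U) : Measurable (fun x : U => (⟪x, v⟫_ℝ)⁻¹ • x) :=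
  (measurable_id.inner measurable_const).inv.smul measurable_id

lemma measurableSet_coneOver (v : U) {F : Set U} (hF : MeasurableSet F) :
    MeasurableSet (coneOver v F) := by
  have h : coneOver v F =
      {x : U | 0 < ⟪x, v⟫_ℝ} ∩ (fun x : U => (⟪x, v⟫_ℝ)⁻¹ • x) ⁻¹' F := by ext x; rfl
  rw [h]
  exact (measurableSet_lt measurable_const (measurable_id.inner measurable_const)).inter
    (measurable_radial v hF)

-- Slice by the hyperplanes `⟪x, v⟫ = τ`: for `τ > 0` the slice of the cone is `τ F`, of area
-- `τ^(dim U - 1)` times that of `F`, and consecutive slices are `dτ/‖v‖` apart.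
open scoped Pointwise in
lemma volume_coneOver_inter {v : U} (hv : v ≠ 0) {F : Set U} (hF : MeasurableSet F)
    (hF1 : ∀ x ∈ F, ⟪x, v⟫_ℝ = 1) {S : Set ℝ} (hS : MeasurableSet S) :
    volume (coneOver v F ∩ {x | ⟪x, v⟫_ℝ ∈ S}) =
      (∫⁻ τ in Set.Ioi 0 ∩ S, ENNReal.ofReal (τ ^ (finrank ℝ U - 1) / ‖v‖)) *
        (Measure.euclideanHausdorffMeasure (finrank ℝ U - 1) : Measure U) F := by
  have hv0 : 0 < ‖v‖ := norm_pos_iff.2 hv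
  -- Normalised by `⟪v', v⟫ = 1`, so that the slice through `τ • v'` is `⟪x, v⟫ = τ`.
  set v' : U := (‖v‖ ^ 2)⁻¹ • v with hv'
  have hv'0 : v' ≠ 0 := smul_ne_zero (by positivity) hv
  have hmeas : MeasurableSet (coneOver v F ∩ {x | ⟪x, v⟫_ℝ ∈ S}) :=
    (measurableSet_coneOver v hF).inter ((measurable_id.inner measurable_const) hS)
  have hslice : ∀ τ : ℝ, (coneOver v F ∩ {x | ⟪x, v⟫_ℝ ∈ S}) ∩
      (AffineSubspace.mk' (τ • v' +ᵥ (0 : U)) (ℝ ∙ v')ᗮ : Set U)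
        = {x | x ∈ coneOver v F ∧ ⟪x, v⟫_ℝ ∈ S ∧ ⟪x, v⟫_ℝ = τ} := by
    intro τ
    ext x
    have : x ∈ (AffineSubspace.mk' (τ • v' +ᵥ (0 : U)) (ℝ ∙ v')ᗮ : Set U) ↔ ⟪x, v⟫_ℝ = τ := by
      rw [SetLike.mem_coe, AffineSubspace.mem_mk', Submodule.mem_orthogonal_singleton_iff_inner_left]
      simp only [vadd_eq_add, add_zero, vsub_eq_sub, inner_sub_left, hv', inner_smul_left,
        inner_smul_right, real_inner_self_eq_norm_sq, map_inv₀, map_pow, conj_trivial]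
      field_simp
      rw [mul_zero, sub_eq_zero]
    simp only [Set.mem_inter_iff, this, Set.mem_ofPred_eq, and_assoc]
  have hval : ∀ τ : ℝ, (Measure.euclideanHausdorffMeasure (finrank ℝ U - 1) : Measure U)
      {x | x ∈ coneOver v F ∧ ⟪x, v⟫_ℝ ∈ S ∧ ⟪x, v⟫_ℝ = τ} =
      (Set.Ioi 0 ∩ S).indicator (fun τ => ENNReal.ofReal (τ ^ (finrank ℝ U - 1)) *
        (Measure.euclideanHausdorffMeasure (finrank ℝ U - 1) : Measure U) F) τ := by
    intro τ
    by_cases hτ : τ ∈ Set.Ioi 0 ∩ S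
    · rw [Set.indicator_of_mem hτ]
      have hτ0 : 0 < τ := hτ.1
      have : {x | x ∈ coneOver v F ∧ ⟪x, v⟫_ℝ ∈ S ∧ ⟪x, v⟫_ℝ = τ} = τ • F := by
        ext x
        rw [Set.mem_smul_set_iff_inv_smul_mem₀ hτ0.ne']
        constructor
        · rintro ⟨⟨_, h2⟩, _, h3⟩
          rwa [h3] at h2
        · intro h
          have h1 := hF1 _ h
          rw [inner_smul_left, conj_trivial, inv_mul_eq_one₀ hτ0.ne'] at h1
          exact ⟨⟨h1 ▸ hτ0, h1 ▸ h⟩, h1 ▸ hτ.2, h1.symm⟩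
      rw [this, Measure.euclideanHausdorffMeasure_smul₀ _ hτ0.ne', ENNReal.smul_def, smul_eq_mul]
      congr 1
      rw [ENNReal.ofReal_pow hτ0.le, ENNReal.coe_pow, ← enorm_eq_nnnorm,
        Real.enorm_of_nonneg hτ0.le]
    · rw [Set.indicator_of_notMem hτ]
      have : {x | x ∈ coneOver v F ∧ ⟪x, v⟫_ℝ ∈ S ∧ ⟪x, v⟫_ℝ = τ} = ∅ := by
        ext x
        simp only [Set.mem_ofPred_eq, Set.mem_empty_iff_false, iff_false]
        rintro ⟨⟨h1, _⟩, h2, rfl⟩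
        exact hτ ⟨h1, h2⟩
      rw [this, measure_empty]
  have key := EuclideanGeometry.euclideanHausdorffMeasure_eq_lintegral (V := U) (0 : U) hv'0 hmeas
  rw [InnerProductSpace.euclideanHausdorffMeasure_eq_volume] at key
  simp_rw [hslice, hval] at key
  have hpm : Measurable fun τ : ℝ => ENNReal.ofReal (τ ^ (finrank ℝ U - 1)) := by fun_prop
  rw [key, lintegral_indicator (measurableSet_Ioi.inter hS), lintegral_mul_const _ hpm,
    ← mul_assoc, ← lintegral_const_mul _ hpm]
  congr 1
  apply lintegral_congr
  intro τ
  have h1 : ‖v'‖ = ‖v‖⁻¹ := by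
    rw [hv', norm_smul, norm_inv, norm_pow, norm_norm]; field_simp
  rw [← ofReal_norm, h1, ← ENNReal.ofReal_mul (by positivity), inv_mul_eq_div]

/-- A product measure is determined by its values on rectangles, and those are given by
`volume_coneOver_inter` applied to measurable parts of `F`. -/
lemma map_polar_coneOver {v : U} (hv : v ≠ 0) {F : Set U} (hF : MeasurableSet F)
    (hF1 : ∀ x ∈ F, ⟪x, v⟫_ℝ = 1)
    (hfin : (Measure.euclideanHausdorffMeasure (finrank ℝ U - 1) : Measure U) F ≠ ⊤) :
    ((volume : Measure U).restrict (coneOver v F)).map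
        (fun x => (⟪x, v⟫_ℝ, (⟪x, v⟫_ℝ)⁻¹ • x)) =
      (((volume : Measure ℝ).restrict (Set.Ioi 0)).withDensity
        (fun τ => ENNReal.ofReal (τ ^ (finrank ℝ U - 1) / ‖v‖))).prod
        ((Measure.euclideanHausdorffMeasure (finrank ℝ U - 1) : Measure U).restrict F) := by
  have : IsFiniteMeasure
      ((Measure.euclideanHausdorffMeasure (finrank ℝ U - 1) : Measure U).restrict F) :=
    ⟨by rw [Measure.restrict_apply_univ]; exact hfin.lt_top⟩
  have hm : Measurable (fun x : U => (⟪x, v⟫_ℝ, (⟪x, v⟫_ℝ)⁻¹ • x)) :=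
    (measurable_id.inner measurable_const).prodMk (measurable_radial v)
  symm
  apply Measure.prod_eq
  intro S B hS hB
  rw [Measure.map_apply hm (hS.prod hB), Measure.restrict_apply (hm (hS.prod hB)),
    withDensity_apply _ hS, Measure.restrict_restrict hS, Measure.restrict_apply hB,
    Set.inter_comm S, ← volume_coneOver_inter hv (hB.inter hF) (fun x hx => hF1 x hx.2) hS]
  congr 1
  ext x
  simp only [coneOver, Set.mem_inter_iff, Set.mem_preimage, Set.mem_prod, Set.mem_ofPred_eq]
  tauto

lemma integral_coneOver {v : U} (hv : v ≠ 0) {F : Set U} (hF : MeasurableSet F)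
    (hF1 : ∀ x ∈ F, ⟪x, v⟫_ℝ = 1)
    (hfin : (Measure.euclideanHausdorffMeasure (finrank ℝ U - 1) : Measure U) F ≠ ⊤)
    {ψ : ℝ → ℝ} (hψ : Measurable ψ) {q : U → ℝ} (hq : Measurable q) :
    ∫ x in coneOver v F, ψ ⟪x, v⟫_ℝ * q ((⟪x, v⟫_ℝ)⁻¹ • x) =
      (‖v‖⁻¹ * ∫ τ in Set.Ioi (0 : ℝ), τ ^ (finrank ℝ U - 1) * ψ τ) *
        ∫ x in F, q x ∂(Measure.euclideanHausdorffMeasure (finrank ℝ U - 1)) := by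
  have hm : Measurable (fun x : U => (⟪x, v⟫_ℝ, (⟪x, v⟫_ℝ)⁻¹ • x)) :=
    (measurable_id.inner measurable_const).prodMk (measurable_radial v)
  have h1 := integral_map (μ := (volume : Measure U).restrict (coneOver v F)) hm.aemeasurable
    (f := fun p : ℝ × U => ψ p.1 * q p.2)
    ((hψ.comp measurable_fst).mul (hq.comp measurable_snd)).aestronglyMeasurable
  have : IsFiniteMeasure
      ((Measure.euclideanHausdorffMeasure (finrank ℝ U - 1) : Measure U).restrict F) :=
    ⟨by rw [Measure.restrict_apply_univ]; exact hfin.lt_top⟩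
  rw [← h1, map_polar_coneOver hv hF hF1 hfin, integral_prod_mul,
    integral_withDensity_eq_integral_toReal_smul (by fun_prop) (by simp),
    ← integral_const_mul ‖v‖⁻¹]
  congr 1
  apply setIntegral_congr_fun measurableSet_Ioi
  intro τ hτ
  have hτ0 : (0 : ℝ) < τ := hτ
  simp only [smul_eq_mul]
  rw [ENNReal.toReal_ofReal (by positivity)]
  ring

end Cone

/-! ### Volume as an exponential integral, and its differentiation -/

section Exponential

variable {U : Type*} [NormedAddCommGroup U] [InnerProductSpace ℝ U] [FiniteDimensional ℝ U]
  [MeasurableSpace U] [BorelSpace U] {n k : ℕ}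

lemma integrable_pow_norm_mul_exp [Nontrivial U] {c : ℝ} (hc : 0 < c) (d : ℕ) :
    Integrable (fun x : U => ‖x‖ ^ d * Real.exp (-c * ‖x‖)) := by
  rw [integrable_fun_norm_addHaar volume (f := fun s : ℝ => s ^ d * Real.exp (-c * s))]
  have h := integrableOn_rpow_mul_exp_neg_mul_rpow (p := 1) (s := ((finrank ℝ U - 1 + d : ℕ) : ℝ))
    (by have : (0 : ℝ) ≤ ((finrank ℝ U - 1 + d : ℕ) : ℝ) := Nat.cast_nonneg _
        linarith) one_pos hc
  refine h.congr_fun (fun s _ => ?_) measurableSet_Ioi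
  simp only [Real.rpow_natCast, Real.rpow_one, smul_eq_mul, pow_add, mul_assoc]

lemma volume_supCoord_le_one [Nontrivial U] (L : U →L[ℝ] EuclideanSpace ℝ (Fin n))
    (hL : Function.Injective L) :
    (volume : Measure U).real {x | supCoord (L x) ≤ 1} =
      (∫ x : U, Real.exp (-supCoord (L x))) / (finrank ℝ U).factorial := by
  have h1 : supCoord (L 0) = 0 := by simp [supCoord]
  have h2 : ∀ x, supCoord (L (-x)) = supCoord (L x) := fun x => by simp [supCoord]
  have h3 : ∀ x y, supCoord (L (x + y)) ≤ supCoord (L x) + supCoord (L y) := fun x y => by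
    rw [map_add]; exact supCoord_add_le _ _
  have h4 : ∀ {x}, supCoord (L x) = 0 → x = 0 := fun {x} h =>
    hL (by rw [eq_zero_of_supCoord_eq_zero h, map_zero])
  have h5 : ∀ (r : ℝ) x, supCoord (L (r • x)) ≤ |r| * supCoord (L x) := fun r x => by
    rw [map_smul, supCoord_smul]
  have hlt := measure_le_eq_lt (volume : Measure U) (g := fun x => supCoord (L x)) h1 h2 h3 h4 h5 1
  have hG := measure_lt_one_eq_integral_div_gamma (volume : Measure U)
    (g := fun x => supCoord (L x)) h1 h2 h3 h4 h5 one_pos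
  rw [← hlt] at hG
  simp only [Real.rpow_one, div_one, Real.Gamma_nat_eq_factorial] at hG
  unfold Measure.real
  rw [hG, ENNReal.toReal_ofReal]
  exact div_nonneg (integral_nonneg fun x => (Real.exp_pos _).le) (Nat.cast_nonneg _)

/-- A 1-Lipschitz map does not increase Hausdorff measure; compare the two images of the unit ball.
-/
lemma normDet_comp_le_of_lipschitz [Nontrivial U] {V W : Type*}
    [NormedAddCommGroup V] [InnerProductSpace ℝ V]
    [NormedAddCommGroup W] [InnerProductSpace ℝ W]
    (f : U →ₗ[ℝ] V) (g : V →ₗ[ℝ] W) (hg : LipschitzWith 1 g) :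
    (g ∘ₗ f).normDet ≤ f.normDet := by
  borelize V W
  set B : Set U := Metric.ball 0 1
  have hB0 : volume B ≠ 0 := (Metric.measure_ball_pos volume (0 : U) one_pos).ne'
  have hBt : volume B ≠ ⊤ := measure_ball_lt_top.ne
  have h1 := (g ∘ₗ f).euclideanHausdorffMeasure_image_eq_normDet_mul_volume B
  have h2 := f.euclideanHausdorffMeasure_image_eq_normDet_mul_volume B
  have h3 : (Measure.euclideanHausdorffMeasure (finrank ℝ U) : Measure W) (g '' (f '' B)) ≤
      (Measure.euclideanHausdorffMeasure (finrank ℝ U) : Measure V) (f '' B) := by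
    have h4 := hg.hausdorffMeasure_image_le (d := (finrank ℝ U : ℝ)) (Nat.cast_nonneg _) (f '' B)
    rw [ENNReal.coe_one, ENNReal.one_rpow, one_mul] at h4
    simp only [Measure.euclideanHausdorffMeasure_def, Measure.smul_apply]
    gcongr
  rw [← Set.image_comp] at h3
  change (Measure.euclideanHausdorffMeasure (finrank ℝ U) : Measure W) ((g ∘ₗ f) '' B) ≤ _ at h3
  rw [h1, h2, ENNReal.mul_le_mul_iff_left hB0 hBt,
    ENNReal.ofReal_le_ofReal_iff f.normDet_nonneg] at h3
  exact h3

variable {H : Submodule ℝ (EuclideanSpace ℝ (Fin n))}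

lemma le_supCoord_coe (x : H) :
    1 / (n + 1) * ‖x‖ ≤ supCoord (x : EuclideanSpace ℝ (Fin n)) := by
  have h := norm_le_mul_supCoord (x : EuclideanSpace ℝ (Fin n))
  have hn : (0 : ℝ) < n + 1 := by positivity
  rw [one_div, inv_mul_le_iff₀ hn]
  exact h

lemma supCoord_pert_sub (M : H →L[ℝ] EuclideanSpace ℝ (Fin n)) (s t : ℝ) (x : H) :
    |supCoord (pert M s x) - supCoord (pert M t x)| ≤ |s - t| * (‖M‖ * ‖x‖) := by
  refine (supCoord_sub_le _ _).trans ?_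
  have : pert M s x - pert M t x = (s - t) • M x := by simp [pert, sub_smul]
  rw [this, supCoord_smul]
  gcongr
  exact (supCoord_le_norm _).trans (M.le_opNorm x)

lemma pert_zero_apply (M : H →L[ℝ] EuclideanSpace ℝ (Fin n)) (x : H) :
    pert M 0 x = (x : EuclideanSpace ℝ (Fin n)) := by simp [pert]

lemma le_supCoord_pert (M : H →L[ℝ] EuclideanSpace ℝ (Fin n)) {t : ℝ}
    (ht : |t| * ‖M‖ ≤ 1 / (2 * (n + 1))) (x : H) :
    1 / (2 * (n + 1)) * ‖x‖ ≤ supCoord (pert M t x) := by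
  have h1 := (abs_le.1 (supCoord_pert_sub M t 0 x)).1
  rw [pert_zero_apply, sub_zero, ← mul_assoc] at h1
  have h2 := le_supCoord_coe x
  have h3 : |t| * ‖M‖ * ‖x‖ ≤ 1 / (2 * (n + 1)) * ‖x‖ := by gcongr
  have h4 : (1 : ℝ) / (n + 1) * ‖x‖ = 1 / (2 * (n + 1)) * ‖x‖ + 1 / (2 * (n + 1)) * ‖x‖ := by
    field_simp; ring
  linarith

lemma continuous_supCoord_pert (M : H →L[ℝ] EuclideanSpace ℝ (Fin n)) (t : ℝ) :
    Continuous fun x => supCoord (pert M t x) :=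
  continuous_supCoord.comp (pert M t).continuous

lemma eventually_abs_mul_le (a : ℝ) {c : ℝ} (hc : 0 < c) : ∀ᶠ t in 𝓝 (0 : ℝ), |t| * a ≤ c := by
  have : Tendsto (fun t : ℝ => |t| * a) (𝓝 0) (𝓝 (|0| * a)) :=
    (continuous_abs.mul continuous_const).tendsto 0
  rw [abs_zero, zero_mul] at this
  exact (this.eventually (gt_mem_nhds hc)).mono fun t ht => ht.le

lemma injective_pert (M : H →L[ℝ] EuclideanSpace ℝ (Fin n)) {t : ℝ}
    (ht : |t| * ‖M‖ ≤ 1 / (2 * (n + 1))) : Function.Injective (pert M t) := by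
  rw [injective_iff_map_eq_zero]
  intro x hx
  have h := le_supCoord_pert M ht x
  rw [hx] at h
  have h0 : supCoord (0 : EuclideanSpace ℝ (Fin n)) = 0 := by simp [supCoord]
  rw [h0] at h
  have hc : (0 : ℝ) < 1 / (2 * (n + 1)) := by positivity
  exact norm_le_zero_iff.1 (nonpos_of_mul_nonpos_right h hc)

/-- Differentiation under the integral sign of `∫ exp (-supCoord (x + t M x))`. -/
lemma hasDerivAt_integral_exp_pert [Nontrivial H] (M : H →L[ℝ] EuclideanSpace ℝ (Fin n))
    {F' : H → ℝ} (hF' : AEStronglyMeasurable F' volume)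
    (hderiv : ∀ᵐ x : H, HasDerivAt (fun t => Real.exp (-supCoord (pert M t x))) (F' x) 0) :
    HasDerivAt (fun t => ∫ x : H, Real.exp (-supCoord (pert M t x))) (∫ x, F' x) 0 := by
  -- Half of the constant in `le_supCoord_coe`; the other half absorbs the perturbation.
  set c : ℝ := 1 / (2 * (n + 1)) with hcdef
  have hc : 0 < c := by positivity
  have hs := eventually_abs_mul_le ‖M‖ hc
  have hmeas : ∀ t, Continuous fun x : H => Real.exp (-supCoord (pert M t x)) := fun t =>
    Real.continuous_exp.comp (continuous_supCoord_pert M t).neg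
  have hbound : ∀ t, |t| * ‖M‖ ≤ c → ∀ x : H,
      Real.exp (-supCoord (pert M t x)) ≤ Real.exp (-c * ‖x‖) := fun t ht x => by
    apply Real.exp_le_exp.2
    have := le_supCoord_pert M ht x
    linarith
  refine (hasDerivAt_integral_of_dominated_loc_of_lip
    (bound := fun x : H => ‖M‖ * (‖x‖ ^ 1 * Real.exp (-c * ‖x‖))) hs
    (Eventually.of_forall fun t => (hmeas t).aestronglyMeasurable) ?_ hF' ?_ ?_ hderiv).2
  · refine (integrable_pow_norm_mul_exp hc 0).mono' (hmeas 0).aestronglyMeasurable ?_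
    refine Eventually.of_forall fun x => ?_
    rw [Real.norm_of_nonneg (Real.exp_pos _).le, pow_zero, one_mul]
    exact hbound 0 (by simpa using hc.le) x
  · refine Eventually.of_forall fun x => ?_
    apply LipschitzOnWith.of_dist_le_mul
    intro s hs t ht
    rw [Real.dist_eq, Real.dist_eq, Real.coe_nnabs,
      abs_of_nonneg (a := ‖M‖ * (‖x‖ ^ 1 * Real.exp (-c * ‖x‖))) (by positivity)]
    -- On `[c‖x‖, ∞)` the function `exp(-·)` is Lipschitz with constant `exp(-c‖x‖)`.
    have key : ∀ a b : ℝ, c * ‖x‖ ≤ a → c * ‖x‖ ≤ b →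
        |Real.exp (-a) - Real.exp (-b)| ≤ Real.exp (-c * ‖x‖) * |a - b| := by
      have aux : ∀ a b : ℝ, c * ‖x‖ ≤ a → a ≤ b →
          |Real.exp (-a) - Real.exp (-b)| ≤ Real.exp (-c * ‖x‖) * |a - b| := by
        intro a b ha hab
        rw [abs_of_nonneg (sub_nonneg.2 (Real.exp_le_exp.2 (by linarith))),
          abs_of_nonpos (by linarith)]
        have h1 : Real.exp (-b) = Real.exp (-a) * Real.exp (a - b) := by
          rw [← Real.exp_add]; congr 1; ring
        have h2 := Real.add_one_le_exp (a - b)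
        have h3 : Real.exp (-a) ≤ Real.exp (-c * ‖x‖) := Real.exp_le_exp.2 (by linarith)
        have h4 := Real.exp_pos (-a)
        calc Real.exp (-a) - Real.exp (-b) = Real.exp (-a) * (1 - Real.exp (a - b)) := by
              rw [h1]; ring
          _ ≤ Real.exp (-a) * (-(a - b)) := by gcongr; linarith
          _ ≤ Real.exp (-c * ‖x‖) * (-(a - b)) := by gcongr; linarith
      intro a b ha hb
      rcases le_total a b with h | h
      · exact aux a b ha h
      · rw [abs_sub_comm, abs_sub_comm a b]; exact aux b a hb h
    refine (key _ _ (le_supCoord_pert M hs x) (le_supCoord_pert M ht x)).trans ?_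
    have := supCoord_pert_sub M s t x
    calc Real.exp (-c * ‖x‖) * |supCoord (pert M s x) - supCoord (pert M t x)|
        ≤ Real.exp (-c * ‖x‖) * (|s - t| * (‖M‖ * ‖x‖)) := by gcongr
      _ = ‖M‖ * (‖x‖ ^ 1 * Real.exp (-c * ‖x‖)) * |s - t| := by ring
  · exact (integrable_pow_norm_mul_exp hc 1).const_mul _

end Exponential

/-! ### The first-order condition -/

section FirstOrder

variable {n k : ℕ} {H : Submodule ℝ (EuclideanSpace ℝ (Fin n))}

open Classical in
/-- The indices `j` with `v_j = ± v`. -/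
noncomputable def parallelIndices (v : H) : Finset (Fin n) :=
  {j | projBasis H j = v ∨ projBasis H j = -v}

open Classical in
/-- The sum of the basis vectors `e_j` over `v_j = v`, minus the sum over `v_j = -v`. -/
noncomputable def signVec (v : H) : EuclideanSpace ℝ (Fin n) :=
  WithLp.toLp 2 fun j => if projBasis H j = v then 1 else if projBasis H j = -v then -1 else 0

lemma signVec_of_eq {v : H} {j : Fin n} (h : projBasis H j = v) : signVec v j = 1 := by
  simp [signVec, h]

lemma neg_ne_of_ne_zero {v : H} (hv : v ≠ 0) : -v ≠ v := fun h => by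
  have h2 : (2 : ℝ) • v = 0 := by
    rw [two_smul]; nth_rewrite 1 [← h]; exact neg_add_cancel v
  exact hv ((smul_eq_zero.1 h2).resolve_left two_ne_zero)

lemma signVec_of_eq_neg {v : H} (hv : v ≠ 0) {j : Fin n} (h : projBasis H j = -v) :
    signVec v j = -1 := by
  have := neg_ne_of_ne_zero hv
  simp [signVec, h, this]

lemma signVec_of_ne {v : H} {j : Fin n} (h : projBasis H j ≠ v) (h' : projBasis H j ≠ -v) :
    signVec v j = 0 := by
  simp [signVec, h, h']

lemma inner_signVec {v : H} (hv : v ≠ 0) (x : H) :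
    ⟪(x : EuclideanSpace ℝ (Fin n)), signVec v⟫_ℝ = (parallelIndices v).card * ⟪x, v⟫_ℝ := by
  classical
  have h1 : ⟪(x : EuclideanSpace ℝ (Fin n)), signVec v⟫_ℝ =
      ∑ j, if j ∈ parallelIndices v then ⟪x, v⟫_ℝ else 0 := by
    rw [PiLp.inner_apply]
    refine Finset.sum_congr rfl fun j _ => ?_
    rw [← inner_projBasis]
    simp only [parallelIndices, Finset.mem_filter, Finset.mem_univ, true_and]
    by_cases ha : projBasis H j = v
    · rw [signVec_of_eq ha, if_pos (Or.inl ha), ha]; simp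
    by_cases hb : projBasis H j = -v
    · rw [signVec_of_eq_neg hv hb, if_pos (Or.inr hb), hb]; simp
    · rw [signVec_of_ne ha hb, if_neg (by tauto)]; simp
  rw [h1, Finset.sum_ite_mem, Finset.univ_inter, Finset.sum_const, nsmul_eq_mul]

lemma orthogonalProjectionOnto_signVec {v : H} (hv : v ≠ 0) :
    H.orthogonalProjectionOnto (signVec v) = ((parallelIndices v).card : ℝ) • v := by
  apply ext_inner_left ℝ
  intro x
  rw [Submodule.inner_orthogonalProjectionOnto_eq_of_mem_left, inner_signVec hv, inner_smul_right]

/-- Projecting back to `H` does not increase the Jacobian, and the composite is an endomorphism `1 +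
(rank one)` whose determinant is the left side. A lower bound tangent at `t = 0` suffices for the
first-order condition. -/
lemma one_add_le_normDet_pert [Nontrivial H] {v : H} (hv : v ≠ 0) (w : H) (t : ℝ) :
    1 + t * ((parallelIndices v).card * ⟪v, w⟫_ℝ) ≤
      (pert (rankOneMap w (signVec v)) t).toLinearMap.normDet := by
  have h1 := normDet_comp_le_of_lipschitz (pert (rankOneMap w (signVec v)) t).toLinearMap
    H.orthogonalProjectionOnto.toLinearMap H.lipschitzWith_orthogonalProjectionOnto
  have h2 : H.orthogonalProjectionOnto.toLinearMap ∘ₗ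
      (pert (rankOneMap w (signVec v)) t).toLinearMap =
      LinearMap.transvection (innerSL ℝ w).toLinearMap
        (t • ((parallelIndices v).card : ℝ) • v) := by
    ext1 x
    simp only [LinearMap.comp_apply, ContinuousLinearMap.coe_coe, pert_rankOneMap_apply, map_add,
      map_smul, orthogonalProjectionOnto_signVec hv, LinearMap.transvection.apply,
      Submodule.orthogonalProjectionOnto_mem_subspace_eq_self, innerSL_apply_apply, real_inner_comm,
      smul_smul]
    congr 2
    ring
  rw [h2, LinearMap.normDet_eq_abs_det, LinearMap.transvection.det] at h1
  refine le_trans (le_trans (le_of_eq ?_) (le_abs_self _)) h1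
  rw [map_smul, map_smul, ContinuousLinearMap.coe_coe, innerSL_apply_apply, smul_eq_mul,
    smul_eq_mul, real_inner_comm]

/-- The points at which `⟪x, v⟫` equals the maximal absolute value of a coordinate. -/
def topCone (v : H) : Set H := {x | ⟪x, v⟫_ℝ = supCoord (x : EuclideanSpace ℝ (Fin n))}

lemma isClosed_topCone (v : H) : IsClosed (topCone v) :=
  isClosed_eq (by fun_prop) (continuous_supCoord.comp continuous_subtype_val)

/-- The sign of `⟪x, v⟫` if this is a coordinate of maximal absolute value, and zero otherwise. -/
noncomputable def topSign (v : H) (x : H) : ℝ :=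
  (topCone v).indicator 1 x - (topCone v).indicator 1 (-x)

lemma mem_topCone {v x : H} :
    x ∈ topCone v ↔ ⟪x, v⟫_ℝ = supCoord (x : EuclideanSpace ℝ (Fin n)) := Iff.rfl

lemma supCoord_neg (x : EuclideanSpace ℝ (Fin n)) : supCoord (-x) = supCoord x := norm_neg _

lemma ae_inner_ne_zero {v : H} (hv : v ≠ 0) : ∀ᵐ x : H, ⟪x, v⟫_ℝ ≠ 0 := by
  have h : (LinearMap.ker (innerSL ℝ v).toLinearMap) ≠ ⊤ := fun h => by
    have : v ∈ LinearMap.ker (innerSL ℝ v).toLinearMap := h ▸ Submodule.mem_top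
    simp at this
    exact hv this
  have h0 := Measure.addHaar_submodule (volume : Measure H) _ h
  filter_upwards [compl_mem_ae_iff.2 h0] with x hx hx0
  exact hx (by simpa [real_inner_comm] using hx0)

/-- A tie between non-parallel `v_i`, `v_j` puts `x` on one of the hyperplanes orthogonal to `v_i ±
v_j`, which are null. -/
lemma ae_generic : ∀ᵐ x : H, ∀ i j : Fin n,
    |⟪x, projBasis H i⟫_ℝ| = |⟪x, projBasis H j⟫_ℝ| →
      projBasis H i = projBasis H j ∨ projBasis H i = -projBasis H j := by
  rw [ae_all_iff]; intro i
  rw [ae_all_iff]; intro j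
  by_cases h1 : projBasis H i = projBasis H j
  · exact Eventually.of_forall fun _ _ => Or.inl h1
  by_cases h2 : projBasis H i = -projBasis H j
  · exact Eventually.of_forall fun _ _ => Or.inr h2
  filter_upwards [ae_inner_ne_zero (sub_ne_zero.2 h1),
    ae_inner_ne_zero (v := projBasis H i + projBasis H j)
      (fun h => h2 (eq_neg_of_add_eq_zero_left h))] with x hx1 hx2 hx
  rw [inner_sub_right, sub_ne_zero] at hx1
  rw [inner_add_right] at hx2
  rcases abs_eq_abs.1 hx with h | h
  · exact absurd h hx1
  · exact absurd (by rw [h]; ring) hx2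

lemma exists_abs_coord_eq_supCoord {x : EuclideanSpace ℝ (Fin n)} (hx : supCoord x ≠ 0) :
    ∃ j, |x j| = supCoord x := by
  by_contra! h
  have hpos : 0 < supCoord x := lt_of_le_of_ne (supCoord_nonneg x) hx.symm
  have : ‖WithLp.ofLp x‖ < supCoord x := by
    rw [pi_norm_lt_iff hpos]
    exact fun j => lt_of_le_of_ne (abs_coord_le_supCoord x j) (h j)
  exact lt_irrefl _ this

lemma supCoord_eq_of_forall_le {x : EuclideanSpace ℝ (Fin n)} {j : Fin n}
    (h : ∀ l, |x l| ≤ |x j|) : supCoord x = |x j| := by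
  apply le_antisymm _ (abs_coord_le_supCoord x j)
  unfold supCoord
  rw [pi_norm_le_iff_of_nonneg (abs_nonneg _)]
  exact h

lemma signVec_eq_of_eq_neg {v : H} (hv : v ≠ 0) {l j : Fin n}
    (h : projBasis H l = -projBasis H j) : signVec v l = -signVec v j := by
  by_cases ha : projBasis H j = v
  · rw [signVec_of_eq ha, signVec_of_eq_neg hv (by rw [h, ha])]
  by_cases hb : projBasis H j = -v
  · rw [signVec_of_eq_neg hv hb, signVec_of_eq (by rw [h, hb, neg_neg]), neg_neg]
  · rw [signVec_of_ne ha hb, signVec_of_ne, neg_zero]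
    · rw [h]; exact fun h' => hb (neg_eq_iff_eq_neg.1 h')
    · rw [h]; exact fun h' => ha (neg_injective h')

lemma signVec_eq_of_eq {v : H} {l j : Fin n}
    (h : projBasis H l = projBasis H j) : signVec v l = signVec v j := by
  simp [signVec, h]

/-- Near `t = 0` the norm is given by a single coordinate, for generic `x`. -/
lemma eventually_supCoord_pert_eq {v : H} (hv : v ≠ 0) (w x : H)
    (hx : ∀ i j : Fin n, |⟪x, projBasis H i⟫_ℝ| = |⟪x, projBasis H j⟫_ℝ| →
      projBasis H i = projBasis H j ∨ projBasis H i = -projBasis H j)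
    {j : Fin n} (hj : |⟪x, projBasis H j⟫_ℝ| = supCoord (x : EuclideanSpace ℝ (Fin n))) :
    ∀ᶠ t in 𝓝 (0 : ℝ), supCoord (pert (rankOneMap w (signVec v)) t x) =
      |⟪x, projBasis H j⟫_ℝ + t * ⟪x, w⟫_ℝ * signVec v j| := by
  have hcoord : ∀ t l, pert (rankOneMap w (signVec v)) t x l =
      ⟪x, projBasis H l⟫_ℝ + t * ⟪x, w⟫_ℝ * signVec v l := fun t l => by
    rw [pert_rankOneMap_apply, inner_projBasis]; simp
  have hev : ∀ᶠ t in 𝓝 (0 : ℝ), ∀ l, |⟪x, projBasis H l⟫_ℝ + t * ⟪x, w⟫_ℝ * signVec v l| ≤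
      |⟪x, projBasis H j⟫_ℝ + t * ⟪x, w⟫_ℝ * signVec v j| := by
    rw [eventually_all]
    intro l
    -- A tied coordinate equals the `j`-th up to sign and is perturbed with the same sign, so the
    -- tie persists for all `t`. This is why all parallel vectors are moved together. Any other
    -- coordinate is strictly smaller and stays so for small `t`.
    by_cases hl : |⟪x, projBasis H l⟫_ℝ| = |⟪x, projBasis H j⟫_ℝ|
    · refine Eventually.of_forall fun t => le_of_eq ?_
      rcases hx l j hl with h | h
      · rw [h, signVec_eq_of_eq h]
      · rw [h, signVec_eq_of_eq_neg hv h, inner_neg_right, ← abs_neg]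
        congr 1; ring
    · have hlt : |⟪x, projBasis H l⟫_ℝ| < |⟪x, projBasis H j⟫_ℝ| := by
        refine lt_of_le_of_ne ?_ hl
        rw [hj, inner_projBasis]
        exact abs_coord_le_supCoord _ l
      have hcl : ∀ i, Continuous fun t : ℝ =>
          |⟪x, projBasis H i⟫_ℝ + t * ⟪x, w⟫_ℝ * signVec v i| := fun i => by fun_prop
      refine ((hcl l).continuousAt.eventually_lt (hcl j).continuousAt ?_).mono fun t ht => ht.le
      simpa using hlt
  filter_upwards [hev] with t ht
  rw [supCoord_eq_of_forall_le (j := j) (by simpa only [hcoord] using ht), hcoord]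

lemma hasDerivAt_exp_supCoord_pert {v : H} (hv : v ≠ 0) {i : Fin n}
    (hvi : projBasis H i = v ∨ projBasis H i = -v) (w x : H) (hx0 : x ≠ 0)
    (hx : ∀ i j : Fin n, |⟪x, projBasis H i⟫_ℝ| = |⟪x, projBasis H j⟫_ℝ| →
      projBasis H i = projBasis H j ∨ projBasis H i = -projBasis H j) :
    HasDerivAt (fun t => Real.exp (-supCoord (pert (rankOneMap w (signVec v)) t x)))
      (-(topSign v x * ⟪x, w⟫_ℝ * Real.exp (-supCoord (x : EuclideanSpace ℝ (Fin n))))) 0 := by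
  have hρ : supCoord (x : EuclideanSpace ℝ (Fin n)) ≠ 0 := fun h =>
    hx0 (Subtype.ext (eq_zero_of_supCoord_eq_zero h))
  have hρpos : 0 < supCoord (x : EuclideanSpace ℝ (Fin n)) :=
    lt_of_le_of_ne (supCoord_nonneg _) hρ.symm
  obtain ⟨j, hj⟩ := exists_abs_coord_eq_supCoord hρ
  rw [← inner_projBasis] at hj
  have hj0 : ⟪x, projBasis H j⟫_ℝ ≠ 0 := fun h => hρ (by rw [← hj, h, abs_zero])
  -- If `v_j = ± v`, both sides are the sign of `⟪x, v⟫`. Otherwise genericity excludes a tie of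
  -- `|⟪x, v⟫|` with the maximum, and both sides vanish.
  have hsign : (SignType.sign ⟪x, projBasis H j⟫_ℝ : ℝ) * signVec v j = topSign v x := by
    unfold topSign
    have hm1 : x ∈ topCone v ↔ ⟪x, v⟫_ℝ = |⟪x, projBasis H j⟫_ℝ| := by rw [hj]; rfl
    have hm2 : -x ∈ topCone v ↔ -⟪x, v⟫_ℝ = |⟪x, projBasis H j⟫_ℝ| := by
      rw [hj, mem_topCone, inner_neg_left, Submodule.coe_neg, supCoord_neg]
    classical
    rw [Set.indicator_apply, Set.indicator_apply]
    simp only [hm1, hm2, Pi.one_apply]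
    by_cases ha : projBasis H j = v
    · rw [signVec_of_eq ha]
      rw [ha] at hj0 ⊢
      rcases lt_or_gt_of_ne hj0 with h | h
      · rw [sign_neg h, abs_of_neg h, if_neg (by linarith), if_pos rfl]; simp
      · rw [sign_pos h, abs_of_pos h, if_pos rfl, if_neg (by linarith)]; simp
    by_cases hb : projBasis H j = -v
    · rw [signVec_of_eq_neg hv hb]
      rw [hb, inner_neg_right] at hj0 ⊢
      rcases lt_or_gt_of_ne hj0 with h | h
      · rw [sign_neg h, abs_of_neg h, if_pos (by ring), if_neg (by linarith)]; simp
      · rw [sign_pos h, abs_of_pos h, if_neg (by linarith), if_pos rfl]; simp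
    · have hne : |⟪x, v⟫_ℝ| ≠ |⟪x, projBasis H j⟫_ℝ| := by
        intro h
        rcases hvi with h' | h'
        · rcases hx j i (by rw [h', h]) with h2 | h2
          · exact ha (h2.trans h')
          · exact hb (by rw [h2, h'])
        · rcases hx j i (by rw [h', inner_neg_right, abs_neg, h]) with h2 | h2
          · exact hb (h2.trans h')
          · exact ha (by rw [h2, h', neg_neg])
      rw [signVec_of_ne ha hb, if_neg, if_neg]
      · simp
      · intro h; exact hne (by rw [← abs_neg, h, abs_abs])
      · intro h; exact hne (by rw [h, abs_abs])
  have hlin : HasDerivAt (fun t : ℝ => ⟪x, projBasis H j⟫_ℝ + t * ⟪x, w⟫_ℝ * signVec v j)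
      (⟪x, w⟫_ℝ * signVec v j) 0 := by
    have := (((hasDerivAt_id (0 : ℝ)).mul_const ⟪x, w⟫_ℝ).mul_const (signVec v j)).const_add
      ⟪x, projBasis H j⟫_ℝ
    simpa using this
  have habs := HasDerivAt.comp (0 : ℝ) (h₂ := fun y : ℝ => |y|)
    (h₂' := (SignType.sign ⟪x, projBasis H j⟫_ℝ : ℝ))
    (by simpa using hasDerivAt_abs hj0) hlin
  have hexp := habs.neg.exp
  have hfin := hexp.congr_of_eventuallyEq (f₁ := fun t =>
      Real.exp (-supCoord (pert (rankOneMap w (signVec v)) t x))) (by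
    filter_upwards [eventually_supCoord_pert_eq hv w x hx hj] with t ht
    rw [ht]; rfl)
  convert! hfin using 1
  simp only [Function.comp, Pi.neg_apply, zero_mul, add_zero]
  rw [← hsign, hj]
  ring

lemma exp_neg_supCoord_le (x : H) : Real.exp (-supCoord (x : EuclideanSpace ℝ (Fin n))) ≤
    Real.exp (-(1 / (n + 1)) * ‖x‖) := by
  apply Real.exp_le_exp.2
  have := le_supCoord_coe x
  linarith

lemma integrable_inner_mul_exp_supCoord [Nontrivial H] (w : H) :
    Integrable fun x : H => ⟪x, w⟫_ℝ * Real.exp (-supCoord (x : EuclideanSpace ℝ (Fin n))) := by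
  have hc : (0 : ℝ) < 1 / (n + 1) := by positivity
  have hcont : Continuous fun x : H => supCoord (x : EuclideanSpace ℝ (Fin n)) :=
    continuous_supCoord.comp continuous_subtype_val
  refine ((integrable_pow_norm_mul_exp hc 1).const_mul ‖w‖).mono'
    (by fun_prop) (Eventually.of_forall fun x => ?_)
  rw [norm_mul, Real.norm_of_nonneg (Real.exp_pos _).le, pow_one, ← mul_assoc, mul_comm ‖w‖]
  gcongr
  · exact norm_inner_le_norm x w
  · exact Real.exp_le_exp.1 (exp_neg_supCoord_le x)

lemma measurable_topSign (v : H) : Measurable (topSign v) := by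
  have h : Measurable ((topCone v).indicator (1 : H → ℝ)) :=
    measurable_one.indicator (isClosed_topCone v).measurableSet
  exact h.sub (h.comp measurable_neg)

/-- The factor multiplying `topSign` is odd, so the cones `topCone v` and `-topCone v` contribute
equally. -/
lemma integral_topSign [Nontrivial H] (v w : H) :
    ∫ x : H, topSign v x * ⟪x, w⟫_ℝ * Real.exp (-supCoord (x : EuclideanSpace ℝ (Fin n))) =
      2 * ∫ x in topCone v, ⟪x, w⟫_ℝ * Real.exp (-⟪x, v⟫_ℝ) := by
  have hS := (isClosed_topCone v).measurableSet
  set f : H → ℝ := fun x => ⟪x, w⟫_ℝ * Real.exp (-supCoord (x : EuclideanSpace ℝ (Fin n)))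
  set g : H → ℝ := (topCone v).indicator f
  have hg : Integrable g := (integrable_inner_mul_exp_supCoord w).indicator hS
  have h1 : ∀ x : H, topSign v x * ⟪x, w⟫_ℝ *
      Real.exp (-supCoord (x : EuclideanSpace ℝ (Fin n))) = g x + g (-x) := by
    intro x
    have hneg : f (-x) = -f x := by
      simp only [f, inner_neg_left, Submodule.coe_neg, supCoord_neg, neg_mul]
    rw [mul_assoc]
    change topSign v x * f x = _
    unfold topSign
    classical
    simp only [g, Set.indicator_apply, hneg, Pi.one_apply]
    split_ifs <;> ring
  simp_rw [h1]
  rw [integral_add hg hg.comp_neg, integral_neg_eq_self, ← two_mul, integral_indicator hS]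
  congr 1
  apply setIntegral_congr_fun hS
  intro x hx
  simp only [f]
  rw [← mem_topCone.1 hx]

/-- The first-order condition at a local maximizer, for the perturbation moving all vectors
parallel to `v` in the direction `w`. -/
lemma first_order_condition (H : Gr n k) (hH : IsLocalMax (sectionVolume n k) H)
    {v : H.1} (hv : v ≠ 0) {i : Fin n} (hvi : projBasis H.1 i = v ∨ projBasis H.1 i = -v)
    (w : H.1) :
    (parallelIndices v).card * ⟪v, w⟫_ℝ *
        ∫ x : H.1, Real.exp (-supCoord (x : EuclideanSpace ℝ (Fin n))) =
      2 * ∫ x in topCone v, ⟪x, w⟫_ℝ * Real.exp (-⟪x, v⟫_ℝ) := by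
  have hnt : Nontrivial H.1 := nontrivial_of_ne v 0 hv
  set M := rankOneMap w (signVec v)
  set a : ℝ := (parallelIndices v).card * ⟪v, w⟫_ℝ
  set D : ℝ → ℝ := fun t => ∫ x : H.1, Real.exp (-supCoord (pert M t x))
  have hcont : Continuous fun x : H.1 => supCoord (x : EuclideanSpace ℝ (Fin n)) :=
    continuous_supCoord.comp continuous_subtype_val
  have hD : HasDerivAt D (∫ x : H.1, -(topSign v x * ⟪x, w⟫_ℝ *
      Real.exp (-supCoord (x : EuclideanSpace ℝ (Fin n))))) 0 := by
    apply hasDerivAt_integral_exp_pert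
    · have := measurable_topSign v
      have := hcont.measurable
      exact Measurable.aestronglyMeasurable (by fun_prop)
    · filter_upwards [ae_generic, ae_inner_ne_zero hv] with x hx hx0
      refine hasDerivAt_exp_supCoord_pert hv hvi w x ?_ hx
      rintro rfl
      simp at hx0
  rw [integral_neg, integral_topSign] at hD
  have hD0 : D 0 = ∫ x : H.1, Real.exp (-supCoord (x : EuclideanSpace ℝ (Fin n))) := by
    simp only [D, pert_zero_apply]
  have hvol : ∀ t, |t| * ‖M‖ ≤ 1 / (2 * (n + 1)) →
      vol k {x | pert M t x ∈ cube n} = D t / k.factorial := fun t ht => by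
    rw [vol_eq_volume H.2]
    have := volume_supCoord_le_one (pert M t) (injective_pert M ht)
    rw [H.2] at this
    simpa only [mem_cube_iff] using this
  have hvol0 : vol k (cubeSection H.1) = D 0 / k.factorial := by
    rw [← hvol 0 (by rw [abs_zero, zero_mul]; positivity)]
    congr 1
    ext x
    simp [cubeSection, pert]
  have hfac : (0 : ℝ) < k.factorial := by exact_mod_cast k.factorial_pos
  -- The true volume, times `k!`, dominates this function near `0` and agrees with it at `0`, where
  -- it is maximal.
  have hmax : IsLocalMax (fun t => (1 + t * a) * D t) 0 := by
    filter_upwards [eventually_vol_pert_le H hH M,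
      eventually_abs_mul_le ‖M‖ (c := 1 / (2 * (n + 1))) (by positivity)] with t h1 h2
    have h3 := vol_image_linearMap H.2 (pert M t).toLinearMap {x | pert M t x ∈ cube n}
    change vol k (pert M t '' _) = _ at h3
    rw [h3, hvol t h2, hvol0, ← mul_div_assoc, div_le_div_iff_of_pos_right hfac] at h1
    rw [zero_mul, add_zero, one_mul]
    refine le_trans ?_ h1
    have hDt : 0 ≤ D t := integral_nonneg fun x => (Real.exp_pos _).le
    exact mul_le_mul_of_nonneg_right (one_add_le_normDet_pert hv w t) hDt
  have hlin : HasDerivAt (fun t : ℝ => 1 + t * a) a 0 := by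
    simpa using ((hasDerivAt_id (0 : ℝ)).mul_const a).const_add 1
  have hzero := hmax.hasDerivAt_eq_zero (hlin.mul hD)
  rw [hD0] at hzero
  linarith

end FirstOrder

/-! ### Faces of the section and the cones over them -/

section Faces

variable {n k : ℕ} {H : Submodule ℝ (EuclideanSpace ℝ (Fin n))}

/-- The part of the section lying in the hyperplane `⟪x, v⟫ = 1`. -/
def faceOf (v : H) : Set H := cubeSection H ∩ {x | ⟪x, v⟫_ℝ = 1}

lemma submodule_inner_smul_left (x y : H) (a : ℝ) : ⟪a • x, y⟫_ℝ = a * ⟪x, y⟫_ℝ :=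
  real_inner_smul_left x y a

lemma submodule_inner_smul_right (x y : H) (a : ℝ) : ⟪x, a • y⟫_ℝ = a * ⟪x, y⟫_ℝ :=
  real_inner_smul_right x y a

lemma mem_cubeSection_iff_supCoord {x : H} :
    x ∈ cubeSection H ↔ supCoord (x : EuclideanSpace ℝ (Fin n)) ≤ 1 := mem_cube_iff

lemma convex_cubeSection : Convex ℝ (cubeSection H) := by
  intro x hx y hy a b ha hb hab
  rw [mem_cubeSection_iff_supCoord] at *
  rw [Submodule.coe_add, Submodule.coe_smul, Submodule.coe_smul]
  refine (supCoord_add_le _ _).trans ?_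
  rw [supCoord_smul, supCoord_smul, abs_of_nonneg ha, abs_of_nonneg hb]
  nlinarith

lemma convex_faceOf (v : H) : Convex ℝ (faceOf v) := by
  apply convex_cubeSection.inter
  intro x hx y hy a b _ _ hab
  have hx' : ⟪x, v⟫_ℝ = 1 := hx
  have hy' : ⟪y, v⟫_ℝ = 1 := hy
  change ⟪a • x + b • y, v⟫_ℝ = 1
  rw [inner_add_left, submodule_inner_smul_left, submodule_inner_smul_left, hx', hy', mul_one, mul_one, hab]

lemma isCompact_faceOf (v : H) : IsCompact (faceOf v) :=
  (isCompact_cubeSection H).inter_right (isClosed_eq (by fun_prop) continuous_const)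

lemma abs_inner_le_supCoord {v : H} {i : Fin n}
    (hvi : projBasis H i = v ∨ projBasis H i = -v) (x : H) :
    |⟪x, v⟫_ℝ| ≤ supCoord (x : EuclideanSpace ℝ (Fin n)) := by
  have h := abs_coord_le_supCoord (x : EuclideanSpace ℝ (Fin n)) i
  rw [← inner_projBasis] at h
  rcases hvi with h' | h'
  · rwa [h'] at h
  · rwa [h', inner_neg_right, abs_neg] at h

lemma abs_inner_le_one {v : H} {i : Fin n} (hvi : projBasis H i = v ∨ projBasis H i = -v)
    {x : H} (hx : x ∈ cubeSection H) : |⟪x, v⟫_ℝ| ≤ 1 :=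
  (abs_inner_le_supCoord hvi x).trans (mem_cubeSection_iff_supCoord.1 hx)

/-- Off the null hyperplane `⟪x, v⟫ = 0`, rescaling `x` to height `1` lands in `P` exactly when `⟪x,
v⟫` is the maximal coordinate. -/
lemma topCone_ae_eq {v : H} (hv : v ≠ 0) {i : Fin n}
    (hvi : projBasis H i = v ∨ projBasis H i = -v) :
    (topCone v : Set H) =ᵐ[volume] (coneOver v (faceOf v) : Set H) := by
  filter_upwards [ae_inner_ne_zero hv] with x hx
  refine propext ?_
  change x ∈ topCone v ↔ x ∈ coneOver v (faceOf v)
  have hle := abs_inner_le_supCoord hvi x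
  constructor
  · intro h
    rw [mem_topCone] at h
    have hpos : 0 < ⟪x, v⟫_ℝ := lt_of_le_of_ne (h ▸ supCoord_nonneg _) hx.symm
    refine ⟨hpos, ?_, ?_⟩
    · rw [mem_cubeSection_iff_supCoord, Submodule.coe_smul, supCoord_smul, ← h,
        abs_of_pos (inv_pos.2 hpos), inv_mul_cancel₀ hx]
    · change ⟪_, v⟫_ℝ = 1
      rw [submodule_inner_smul_left, inv_mul_cancel₀ hx]
  · rintro ⟨hpos, h, _⟩
    rw [mem_cubeSection_iff_supCoord, Submodule.coe_smul, supCoord_smul,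
      abs_of_pos (inv_pos.2 hpos), inv_mul_le_one₀ hpos] at h
    exact le_antisymm ((le_abs_self _).trans hle) h

lemma lintegral_pow_Ioc (k : ℕ) (hk : 1 ≤ k) {c : ℝ} (hc : 0 < c) :
    ∫⁻ τ in Set.Ioi (0 : ℝ) ∩ Set.Iic 1, ENNReal.ofReal (τ ^ (k - 1) / c) =
      ENNReal.ofReal ((k * c)⁻¹) := by
  rw [Set.Ioi_inter_Iic, ← ofReal_integral_eq_lintegral_ofReal]
  · congr 1
    rw [← intervalIntegral.integral_of_le zero_le_one, intervalIntegral.integral_div, integral_pow]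
    rw [show k - 1 + 1 = k by omega, Nat.cast_sub hk]
    have : k ≠ 0 := by omega
    simp [this]
    field_simp
  · exact (Continuous.integrableOn_Icc (by fun_prop)).mono_set Set.Ioc_subset_Icc_self
  · filter_upwards [ae_restrict_mem measurableSet_Ioc] with τ hτ
    have : 0 < τ := hτ.1
    simp only [Pi.zero_apply]
    positivity

lemma integral_pow_mul_exp (k : ℕ) (hk : 1 ≤ k) :
    ∫ τ in Set.Ioi (0 : ℝ), τ ^ (k - 1) * (τ * Real.exp (-τ)) = k.factorial := by
  rw [← Real.Gamma_nat_eq_factorial, Real.Gamma_eq_integral (by positivity)]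
  apply setIntegral_congr_fun measurableSet_Ioi
  intro τ _
  simp only [add_sub_cancel_right, Real.rpow_natCast]
  obtain ⟨m, rfl⟩ : ∃ m, k = m + 1 := ⟨k - 1, by omega⟩
  rw [Nat.add_sub_cancel, pow_succ]
  ring

/-- The truncated cone over a face. -/
def truncCone (v : H) : Set H := coneOver v (faceOf v) ∩ {x | ⟪x, v⟫_ℝ ∈ Set.Iic 1}

lemma truncCone_subset (v : H) : truncCone v ⊆ cubeSection H := by
  rintro x ⟨⟨hpos, h, _⟩, h1⟩
  have h1 : ⟪x, v⟫_ℝ ≤ 1 := h1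
  rw [mem_cubeSection_iff_supCoord, Submodule.coe_smul, supCoord_smul,
    abs_of_pos (inv_pos.2 hpos), inv_mul_le_one₀ hpos] at h
  exact mem_cubeSection_iff_supCoord.2 (h.trans h1)

lemma volume_truncCone (hk : 1 ≤ k) (hH : finrank ℝ H = k) {v : H} (hv : v ≠ 0) :
    volume (truncCone v) = ENNReal.ofReal ((k * ‖v‖)⁻¹) *
      (Measure.euclideanHausdorffMeasure (k - 1) : Measure H) (faceOf v) := by
  have h := volume_coneOver_inter hv (isCompact_faceOf v).measurableSet (fun x hx => hx.2)
    (measurableSet_Iic (a := (1 : ℝ)))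
  rw [hH, lintegral_pow_Ioc k hk (norm_pos_iff.2 hv)] at h
  exact h

/-- The truncated cone lies in the compact `P`, and its volume is a positive multiple of the area.
-/
lemma area_faceOf_ne_top (hk : 1 ≤ k) (hH : finrank ℝ H = k) {v : H} (hv : v ≠ 0) :
    (Measure.euclideanHausdorffMeasure (k - 1) : Measure H) (faceOf v) ≠ ⊤ := by
  intro h
  have h1 := volume_truncCone hk hH hv
  have hpos : 0 < ((k : ℝ) * ‖v‖)⁻¹ := by
    have := norm_pos_iff.2 hv
    have : (0 : ℝ) < k := by exact_mod_cast hk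
    positivity
  rw [h, ENNReal.mul_top (ENNReal.ofReal_pos.2 hpos).ne'] at h1
  exact ((measure_mono (truncCone_subset v)).trans_lt
    (isCompact_cubeSection H).measure_lt_top).ne h1

/-- A nonzero vector that is, up to sign, one of the projections `v_i`. -/
def IsSignedProj (v : H) : Prop := v ≠ 0 ∧ ∃ i, projBasis H i = v ∨ projBasis H i = -v

lemma IsSignedProj.neg {v : H} (hv : IsSignedProj v) : IsSignedProj (-v) := by
  obtain ⟨h0, i, hi⟩ := hv
  exact ⟨neg_ne_zero.2 h0, i, by rw [neg_neg]; exact hi.symm⟩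

lemma IsSignedProj.abs_inner_le_one {v : H} (hv : IsSignedProj v) {x : H}
    (hx : x ∈ cubeSection H) : |⟪x, v⟫_ℝ| ≤ 1 :=
  CubeSection.abs_inner_le_one hv.2.choose_spec hx

lemma IsSignedProj.card_pos {v : H} (hv : IsSignedProj v) : 0 < (parallelIndices v).card := by
  obtain ⟨_, i, hi⟩ := hv
  exact Finset.card_pos.2 ⟨i, by simpa [parallelIndices] using hi⟩

lemma vectorSpan_eq_top_of_ball_subset {U : Type*} [NormedAddCommGroup U] [InnerProductSpace ℝ U]
    {A : Set U} (hA : Metric.ball 0 1 ⊆ A) : vectorSpan ℝ A = ⊤ := by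
  have h : affineSpan ℝ (Metric.ball (0 : U) 1) = ⊤ :=
    Metric.isOpen_ball.affineSpan_eq_top ⟨0, Metric.mem_ball_self one_pos⟩
  have h1 : vectorSpan ℝ (Metric.ball (0 : U) 1) = ⊤ := by
    rw [← direction_affineSpan, h, AffineSubspace.direction_top]
  exact top_unique (h1 ▸ vectorSpan_mono ℝ hA)

lemma vectorSpan_cubeSection : vectorSpan ℝ (cubeSection H) = ⊤ :=
  vectorSpan_eq_top_of_ball_subset (ball_subset_cubeSection H)

end Faces

/-! ### Facets, centroids and cone volumes at a local maximizer -/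

section LocalMax

variable {n k : ℕ} {H : Gr n k}

/-- First moments of a face of a locally maximal section. -/
lemma integral_inner_faceOf (hk : 2 ≤ k) (hH : IsLocalMax (sectionVolume n k) H) {v : H.1}
    (hv : IsSignedProj v) (w : H.1) :
    ∫ x in faceOf v, ⟪x, w⟫_ℝ ∂(Measure.euclideanHausdorffMeasure (k - 1)) =
      (parallelIndices v).card * vol k (cubeSection H.1) * ‖v‖ / 2 * ⟪v, w⟫_ℝ := by
  obtain ⟨hv0, i, hi⟩ := hv
  have hnt : Nontrivial H.1 := nontrivial_of_ne v 0 hv0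
  have hE := first_order_condition H hH hv0 hi w
  have hvol : vol k (cubeSection H.1) =
      (∫ x : H.1, Real.exp (-supCoord (x : EuclideanSpace ℝ (Fin n)))) / k.factorial := by
    rw [vol_eq_volume H.2]
    have := volume_supCoord_le_one H.1.subtypeL H.1.subtype_injective
    rw [H.2] at this
    refine Eq.trans ?_ this
    congr 1
    ext x
    exact mem_cubeSection_iff_supCoord
  have hfin := area_faceOf_ne_top (by omega) H.2 hv0
  -- The extra factor `τ` in `ψ` comes from the homogeneity of `⟪x, w⟫`; the radial integral is then
  -- `Γ(k + 1) = k!`, which cancels the factorial in the volume formula.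
  have hcone := integral_coneOver hv0 (isCompact_faceOf v).measurableSet (fun x hx => hx.2)
    (by rw [H.2]; exact hfin) (ψ := fun τ => τ * Real.exp (-τ)) (by fun_prop)
    (q := fun x => ⟪x, w⟫_ℝ) (by fun_prop)
  rw [H.2, integral_pow_mul_exp k (by omega)] at hcone
  rw [setIntegral_congr_set (topCone_ae_eq hv0 hi)] at hE
  have hcongr : ∫ x in coneOver v (faceOf v), ⟪x, w⟫_ℝ * Real.exp (-⟪x, v⟫_ℝ) =
      ∫ x in coneOver v (faceOf v), ⟪x, v⟫_ℝ * Real.exp (-⟪x, v⟫_ℝ) *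
        ⟪(⟪x, v⟫_ℝ)⁻¹ • x, w⟫_ℝ := by
    apply setIntegral_congr_fun (measurableSet_coneOver v (isCompact_faceOf v).measurableSet)
    intro x hx
    have : ⟪x, v⟫_ℝ ≠ 0 := hx.1.ne'
    simp only [submodule_inner_smul_left]
    field_simp
  rw [hcongr, hcone] at hE
  have hfac : (k.factorial : ℝ) ≠ 0 := by exact_mod_cast k.factorial_ne_zero
  have hv1 : ‖v‖ ≠ 0 := norm_ne_zero_iff.2 hv0
  rw [eq_div_iff hfac] at hvol
  rw [← hvol] at hE
  have hE2 : (k.factorial : ℝ) * ((parallelIndices v).card * ⟪v, w⟫_ℝ * vol k (cubeSection H.1)) =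
      k.factorial * (2 * ‖v‖⁻¹ *
        ∫ x in faceOf v, ⟪x, w⟫_ℝ ∂(Measure.euclideanHausdorffMeasure (k - 1))) := by
    linarith
  have hE3 := mul_left_cancel₀ hfac hE2
  field_simp at hE3
  linarith

/-- The first-moment identity with `w = v`, since `⟪x, v⟫ = 1` on the face. -/
lemma area_faceOf (hk : 2 ≤ k) (hH : IsLocalMax (sectionVolume n k) H) {v : H.1}
    (hv : IsSignedProj v) :
    (Measure.euclideanHausdorffMeasure (k - 1) : Measure H.1).real (faceOf v) =
      (parallelIndices v).card * vol k (cubeSection H.1) * ‖v‖ ^ 3 / 2 := by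
  have h := integral_inner_faceOf hk hH hv v
  have h1 : ∫ x in faceOf v, ⟪x, v⟫_ℝ ∂(Measure.euclideanHausdorffMeasure (k - 1)) =
      ∫ x in faceOf v, (1 : ℝ) ∂(Measure.euclideanHausdorffMeasure (k - 1)) :=
    setIntegral_congr_fun (isCompact_faceOf v).measurableSet fun x hx => hx.2
  rw [h1, setIntegral_const, smul_eq_mul, mul_one, real_inner_self_eq_norm_sq] at h
  rw [h]
  ring

lemma area_faceOf_pos (hk : 2 ≤ k) (hH : IsLocalMax (sectionVolume n k) H) {v : H.1}
    (hv : IsSignedProj v) :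
    0 < (Measure.euclideanHausdorffMeasure (k - 1) : Measure H.1).real (faceOf v) := by
  rw [area_faceOf hk hH hv]
  have h1 := vol_cubeSection_pos H
  have h2 := norm_pos_iff.2 hv.1
  have h3 : (0 : ℝ) < (parallelIndices v).card := by exact_mod_cast hv.card_pos
  positivity

lemma area_faceOf_ne_zero (hk : 2 ≤ k) (hH : IsLocalMax (sectionVolume n k) H) {v : H.1}
    (hv : IsSignedProj v) :
    (Measure.euclideanHausdorffMeasure (k - 1) : Measure H.1) (faceOf v) ≠ 0 := fun h => by
  have := area_faceOf_pos hk hH hv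
  rw [Measure.real, h, ENNReal.toReal_zero] at this
  exact lt_irrefl _ this

lemma faceOf_nonempty (hk : 2 ≤ k) (hH : IsLocalMax (sectionVolume n k) H) {v : H.1}
    (hv : IsSignedProj v) : (faceOf v).Nonempty :=
  nonempty_of_measure_ne_zero (area_faceOf_ne_zero hk hH hv)

lemma finrank_vectorSpan_faceOf (hk : 2 ≤ k) (hH : IsLocalMax (sectionVolume n k) H) {v : H.1}
    (hv : IsSignedProj v) : finrank ℝ (vectorSpan ℝ (faceOf v)) + 1 = k := by
  obtain ⟨p, hp⟩ := faceOf_nonempty hk hH hv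
  apply le_antisymm
  · have hle : vectorSpan ℝ (faceOf v) ≤ (ℝ ∙ v)ᗮ := by
      rw [vectorSpan_def, Submodule.span_le]
      rintro _ ⟨x, hx, y, hy, rfl⟩
      have hx' : ⟪x, v⟫_ℝ = 1 := hx.2
      have hy' : ⟪y, v⟫_ℝ = 1 := hy.2
      rw [SetLike.mem_coe, Submodule.mem_orthogonal_singleton_iff_inner_left]
      simp only [vsub_eq_sub, inner_sub_left, hx', hy', sub_self]
    have h1 := Submodule.finrank_mono hle
    have h2 := Submodule.finrank_add_finrank_orthogonal (ℝ ∙ v)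
    rw [finrank_span_singleton hv.1, H.2] at h2
    omega
  · have htop : Submodule.span ℝ (faceOf v) = ⊤ := by
      by_contra h
      have h0 := Measure.addHaar_submodule (volume : Measure H.1) _ h
      have hsub : truncCone v ⊆ (Submodule.span ℝ (faceOf v) : Set H.1) := by
        rintro x ⟨⟨hpos, hx⟩, _⟩
        have := Submodule.smul_mem _ ⟪x, v⟫_ℝ (Submodule.subset_span (R := ℝ) hx)
        rwa [smul_inv_smul₀ hpos.ne'] at this
      have h1 := measure_mono_null hsub h0
      rw [volume_truncCone (by omega) H.2 hv.1, mul_eq_zero, ENNReal.ofReal_eq_zero] at h1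
      rcases h1 with h1 | h1
      · have := norm_pos_iff.2 hv.1
        have : (0 : ℝ) < k := by exact_mod_cast (by omega : 0 < k)
        have : 0 < ((k : ℝ) * ‖v‖)⁻¹ := by positivity
        linarith
      · exact area_faceOf_ne_zero hk hH hv h1
    have hle : Submodule.span ℝ (faceOf v) ≤ vectorSpan ℝ (faceOf v) ⊔ (ℝ ∙ p) := by
      rw [Submodule.span_le]
      intro x hx
      rw [← sub_add_cancel x p]
      exact Submodule.add_mem_sup (vsub_mem_vectorSpan ℝ hx hp)
        (Submodule.mem_span_singleton_self p)
    have h1 := Submodule.finrank_mono hle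
    have h2 := Submodule.finrank_add_le_finrank_add_finrank (vectorSpan ℝ (faceOf v)) (ℝ ∙ p)
    have h3 := finrank_span_le_card (R := ℝ) ({p} : Set H.1)
    rw [htop, finrank_top, H.2] at h1
    simp at h3
    omega

lemma isFacet_faceOf (hk : 2 ≤ k) (hH : IsLocalMax (sectionVolume n k) H) {v : H.1}
    (hv : IsSignedProj v) : IsFacet (cubeSection H.1) (faceOf v) := by
  obtain ⟨p, hp⟩ := faceOf_nonempty hk hH hv
  refine ⟨fun _ => ⟨innerSL ℝ v, ?_⟩, ⟨p, hp⟩, ?_⟩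
  · ext x
    simp only [Set.mem_ofPred_eq, innerSL_apply_apply]
    constructor
    · rintro ⟨hx, hx1⟩
      have hx1 : ⟪x, v⟫_ℝ = 1 := hx1
      refine ⟨hx, fun y hy => ?_⟩
      rw [real_inner_comm, real_inner_comm x, hx1]
      exact (le_abs_self _).trans (hv.abs_inner_le_one hy)
    · rintro ⟨hx, hmax⟩
      have h1 := hmax p hp.1
      have hp1 : ⟪p, v⟫_ℝ = 1 := hp.2
      rw [real_inner_comm, hp1, real_inner_comm] at h1
      exact ⟨hx, le_antisymm ((le_abs_self _).trans (hv.abs_inner_le_one hx)) h1⟩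
  · rw [finrank_vectorSpan_faceOf hk hH hv, vectorSpan_cubeSection, finrank_top, H.2]

lemma centroid_eq_average (hk : 2 ≤ k) (hH : IsLocalMax (sectionVolume n k) H) {v : H.1}
    (hv : IsSignedProj v) : centroid (faceOf v) =
      ⨍ x in faceOf v, x ∂(Measure.euclideanHausdorffMeasure (k - 1)) := by
  have : finrank ℝ (vectorSpan ℝ (faceOf v)) = k - 1 := by
    have := finrank_vectorSpan_faceOf hk hH hv; omega
  unfold centroid
  rw [this]

lemma integrableOn_id_faceOf (hk : 2 ≤ k) {v : H.1} (hv : v ≠ 0) :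
    IntegrableOn (fun x : H.1 => x) (faceOf v) (Measure.euclideanHausdorffMeasure (k - 1)) := by
  obtain ⟨R, hR⟩ := isBounded_iff_forall_norm_le.1 (isCompact_faceOf v).isBounded
  exact Measure.integrableOn_of_bounded (area_faceOf_ne_top (by omega) H.2 hv)
    measurable_id.aestronglyMeasurable (M := R)
    (ae_restrict_of_forall_mem (isCompact_faceOf v).measurableSet hR)

lemma centroid_faceOf (hk : 2 ≤ k) (hH : IsLocalMax (sectionVolume n k) H) {v : H.1}
    (hv : IsSignedProj v) : centroid (faceOf v) = (‖v‖ ^ 2)⁻¹ • v := by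
  rw [centroid_eq_average hk hH hv, setAverage_eq]
  apply ext_inner_left ℝ
  intro w
  rw [submodule_inner_smul_right, submodule_inner_smul_right,
    ← integral_inner (integrableOn_id_faceOf hk hv.1)]
  simp_rw [real_inner_comm _ w]
  rw [integral_inner_faceOf hk hH hv, area_faceOf hk hH hv]
  have h1 := (vol_cubeSection_pos H).ne'
  have h2 := norm_ne_zero_iff.2 hv.1
  have h3 : ((parallelIndices v).card : ℝ) ≠ 0 := by exact_mod_cast hv.card_pos.ne'
  field_simp

lemma centroid_mem_faceOf (hk : 2 ≤ k) (hH : IsLocalMax (sectionVolume n k) H) {v : H.1}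
    (hv : IsSignedProj v) : centroid (faceOf v) ∈ faceOf v := by
  rw [centroid_eq_average hk hH hv]
  exact (convex_faceOf v).set_average_mem (isCompact_faceOf v).isClosed
    (area_faceOf_ne_zero hk hH hv) (area_faceOf_ne_top (by omega) H.2 hv.1)
    (ae_restrict_mem (isCompact_faceOf v).measurableSet) (integrableOn_id_faceOf hk hv.1)

lemma mem_line {v x : H.1} : x ∈ line v ↔ ∃ a : ℝ, a • v = x := Submodule.mem_span_singleton

lemma line_inter_faceOf (hk : 2 ≤ k) (hH : IsLocalMax (sectionVolume n k) H) {v : H.1}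
    (hv : IsSignedProj v) : line v ∩ faceOf v = {centroid (faceOf v)} := by
  have h2 := norm_ne_zero_iff.2 hv.1
  ext x
  rw [Set.mem_singleton_iff]
  constructor
  · rintro ⟨hx, _, h1⟩
    obtain ⟨a, rfl⟩ := mem_line.1 hx
    have h1 : ⟪a • v, v⟫_ℝ = 1 := h1
    rw [submodule_inner_smul_left, real_inner_self_eq_norm_sq] at h1
    rw [centroid_faceOf hk hH hv, eq_inv_of_mul_eq_one_left h1]
  · rintro rfl
    refine ⟨?_, centroid_mem_faceOf hk hH hv⟩
    rw [centroid_faceOf hk hH hv]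
    exact mem_line.2 ⟨_, rfl⟩

lemma vol_convexHull_insert_zero (hk : 2 ≤ k) (hH : IsLocalMax (sectionVolume n k) H) {v : H.1}
    (hv : IsSignedProj v) : vol k (convexHull ℝ (insert 0 (faceOf v))) =
      (parallelIndices v).card * ‖v‖ ^ 2 / (2 * k) * vol k (cubeSection H.1) := by
  have hnt : Nontrivial H.1 := nontrivial_of_ne v 0 hv.1
  -- The height `⟪x, v⟫` is the parameter of `x` on the segment from `0` to the face.
  have hset : convexHull ℝ (insert 0 (faceOf v)) = insert 0 (truncCone v) := by
    rw [convexHull_insert (faceOf_nonempty hk hH hv), (convex_faceOf v).convexHull_eq]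
    ext x
    simp only [convexJoin_singleton_left, Set.mem_iUnion, segment_eq_image, Set.mem_image,
      smul_zero, zero_add, exists_prop, Set.mem_insert_iff]
    constructor
    · rintro ⟨y, hy, θ, hθ, rfl⟩
      rcases hθ.1.eq_or_lt with h | h
      · left; rw [← h, zero_smul]
      · right
        have hy1 : ⟪y, v⟫_ℝ = 1 := hy.2
        have h1 : ⟪θ • y, v⟫_ℝ = θ := by rw [submodule_inner_smul_left, hy1, mul_one]
        refine ⟨⟨h1.symm ▸ h, ?_⟩, ?_⟩
        · rw [h1, inv_smul_smul₀ h.ne']; exact hy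
        · change ⟪θ • y, v⟫_ℝ ≤ 1
          rw [h1]; exact hθ.2
    · rintro (rfl | ⟨⟨hpos, hx⟩, h1⟩)
      · obtain ⟨y, hy⟩ := faceOf_nonempty hk hH hv
        exact ⟨y, hy, 0, by simp, zero_smul _ _⟩
      · exact ⟨_, hx, ⟪x, v⟫_ℝ, ⟨hpos.le, h1⟩, smul_inv_smul₀ hpos.ne' x⟩
  have hk0 : (0 : ℝ) < k := by exact_mod_cast (by omega : 0 < k)
  have hv1 := norm_pos_iff.2 hv.1
  rw [hset, vol_eq_volume H.2, measureReal_congr (insert_ae_eq_self 0 (truncCone v)), Measure.real,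
    volume_truncCone (by omega) H.2 hv.1, ENNReal.toReal_mul,
    ENNReal.toReal_ofReal (by positivity), ← Measure.real, area_faceOf hk hH hv]
  field_simp

/-- A facet lies in one of the hyperplanes `⟪x, ± v_i⟫ = 1`. -/
lemma exists_faceOf_superset (hk : 2 ≤ k) (hH : IsLocalMax (sectionVolume n k) H) {F : Set H.1}
    (hF : IsFacet (cubeSection H.1) F) : ∃ v : H.1, IsSignedProj v ∧ F ⊆ faceOf v := by
  obtain ⟨hexp, hne, hdim⟩ := hF
  by_contra! hcon
  have hsub : F ⊆ cubeSection H.1 := hexp.subset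
  have hconv : Convex ℝ F := hexp.convex convex_cubeSection
  have hproj : ∀ i, IsSignedProj (projBasis H.1 i) := fun i =>
    ⟨projBasis_ne_zero hk H hH i, i, Or.inl rfl⟩
  have hstrict : ∀ v : H.1, IsSignedProj v → ∃ y ∈ F, ⟪y, v⟫_ℝ < 1 := fun v hv => by
    obtain ⟨y, hy, hy'⟩ := Set.not_subset.1 (hcon v hv)
    refine ⟨y, hy, lt_of_le_of_ne ((le_abs_self _).trans (hv.abs_inner_le_one (hsub hy))) ?_⟩
    exact fun h => hy' ⟨hsub hy, h⟩
  have hmid : ∀ i, ∃ y ∈ F, |⟪y, projBasis H.1 i⟫_ℝ| < 1 := fun i => by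
    obtain ⟨y, hy, hy1⟩ := hstrict _ (hproj i)
    obtain ⟨z, hz, hz1⟩ := hstrict _ (hproj i).neg
    have hy2 := abs_le.1 ((hproj i).abs_inner_le_one (hsub hy))
    have hz2 := abs_le.1 ((hproj i).abs_inner_le_one (hsub hz))
    rw [inner_neg_right] at hz1
    refine ⟨(1 / 2 : ℝ) • y + (1 / 2 : ℝ) • z,
      hconv hy hz (by norm_num) (by norm_num) (by norm_num), ?_⟩
    rw [inner_add_left, submodule_inner_smul_left, submodule_inner_smul_left, abs_lt]
    constructor <;> linarith
  choose y hyF hy1 using hmid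
  have hkn : k ≤ n := by
    have := Submodule.finrank_le H.1
    rwa [H.2, finrank_euclideanSpace_fin] at this
  have hn : (0 : ℝ) < n := by exact_mod_cast (by omega : 0 < n)
  -- Averaging points of `F` that are each strict for one index gives a point of `F` strict for all
  -- of them, hence interior to `P`.
  set z : H.1 := ∑ j, (1 / n : ℝ) • y j
  have hzF : z ∈ F := hconv.sum_mem (fun _ _ => by positivity)
    (by rw [Finset.sum_const, Finset.card_univ, Fintype.card_fin, nsmul_eq_mul]; field_simp)
    (fun j _ => hyF j)
  have hz1 : ∀ i, |⟪z, projBasis H.1 i⟫_ℝ| < 1 := fun i => by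
    calc |⟪z, projBasis H.1 i⟫_ℝ| = |∑ j, (1 / n : ℝ) * ⟪y j, projBasis H.1 i⟫_ℝ| := by
          simp only [z, sum_inner, submodule_inner_smul_left]
      _ ≤ ∑ j, |(1 / n : ℝ) * ⟪y j, projBasis H.1 i⟫_ℝ| := Finset.abs_sum_le_sum_abs _ _
      _ < ∑ _j : Fin n, (1 / n : ℝ) := by
          have hterm : ∀ j, |(1 / n : ℝ) * ⟪y j, projBasis H.1 i⟫_ℝ| =
              (1 / n : ℝ) * |⟪y j, projBasis H.1 i⟫_ℝ| := fun j => by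
            rw [abs_mul, abs_of_pos (by positivity)]
          refine Finset.sum_lt_sum (fun j _ => ?_) ⟨i, Finset.mem_univ _, ?_⟩
          · rw [hterm]
            exact mul_le_of_le_one_right (by positivity)
              ((hproj i).abs_inner_le_one (hsub (hyF j)))
          · rw [hterm]
            exact mul_lt_of_lt_one_right (by positivity) (hy1 i)
      _ = 1 := by
          rw [Finset.sum_const, Finset.card_univ, Fintype.card_fin, nsmul_eq_mul]; field_simp
  obtain ⟨l, hl⟩ := hexp hne
  have hnhds : ∀ᶠ x in 𝓝 z, x ∈ cubeSection H.1 := by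
    have : ∀ᶠ x in 𝓝 z, ∀ i, |⟪x, projBasis H.1 i⟫_ℝ| < 1 := by
      rw [eventually_all]
      intro i
      have hc : Continuous fun x : H.1 => |⟪x, projBasis H.1 i⟫_ℝ| := by fun_prop
      exact hc.continuousAt.eventually_lt continuousAt_const (hz1 i)
    filter_upwards [this] with x hx
    exact mem_cubeSection.2 fun i => (hx i).le
  have hlmax : ∀ x ∈ F, ∀ y ∈ cubeSection H.1, l y ≤ l x := fun x hx => by
    rw [hl] at hx; exact hx.2
  -- A linear functional with an interior maximum is zero, so it exposes all of `P`, against the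
  -- dimension of a facet.
  have hloc : IsLocalMax l z := hnhds.mono fun x hx => hlmax z hzF x hx
  have hl0 : l = 0 := hloc.hasFDerivAt_eq_zero l.hasFDerivAt
  have hFP : F = cubeSection H.1 := by
    rw [hl]; ext x; simp [hl0]
  rw [hFP] at hdim
  omega

/-- `F` lies in some `faceOf v` of the same dimension, so both have the same direction space. The
functional exposing `F` is constant along it, hence maximal on all of `faceOf v`. -/
lemma exists_eq_faceOf (hk : 2 ≤ k) (hH : IsLocalMax (sectionVolume n k) H) {F : Set H.1}
    (hF : IsFacet (cubeSection H.1) F) : ∃ v : H.1, IsSignedProj v ∧ F = faceOf v := by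
  obtain ⟨v, hv, hsub⟩ := exists_faceOf_superset hk hH hF
  refine ⟨v, hv, hsub.antisymm fun y hy => ?_⟩
  obtain ⟨hexp, ⟨x, hx⟩, hdim⟩ := hF
  rw [vectorSpan_cubeSection, finrank_top, H.2] at hdim
  have hspan : vectorSpan ℝ F = vectorSpan ℝ (faceOf v) := by
    apply Submodule.eq_of_le_of_finrank_eq (vectorSpan_mono ℝ hsub)
    have := finrank_vectorSpan_faceOf hk hH hv
    omega
  obtain ⟨l, hl⟩ := hexp ⟨x, hx⟩
  have hle : vectorSpan ℝ F ≤ LinearMap.ker l.toLinearMap := by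
    rw [vectorSpan_def, Submodule.span_le]
    rintro _ ⟨a, ha, b, hb, rfl⟩
    rw [hl] at ha hb
    have := le_antisymm (hb.2 a ha.1) (ha.2 b hb.1)
    simp [this]
  have hyx : y - x ∈ LinearMap.ker l.toLinearMap :=
    hle (hspan ▸ vsub_mem_vectorSpan ℝ hy (hsub hx))
  have hlyx : l y = l x := by
    have h : l (y - x) = 0 := hyx
    rwa [map_sub, sub_eq_zero] at h
  rw [hl] at hx ⊢
  exact ⟨hy.1, fun z hz => by rw [hlyx]; exact hx.2 z hz⟩

lemma line_neg (v : H.1) : line (-v) = line v := by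
  unfold line
  rw [← Set.neg_singleton, Submodule.span_neg]

/-- If the line of `u = v_j` passes through the centroid `v/|v|²`, then `v = b u`. The centroid
`v/|v|²` satisfies `|⟪·, u⟫| ≤ 1`, giving `|b| ≥ 1`; the centroid `u/|u|²` satisfies `|⟪·, v⟫| ≤ 1`,
giving `|b| ≤ 1`. So `v = ± u`. -/
lemma centroidIndices_faceOf (hk : 2 ≤ k) (hH : IsLocalMax (sectionVolume n k) H) {v : H.1}
    (hv : IsSignedProj v) : centroidIndices H.1 (faceOf v) = parallelIndices v := by
  ext j
  simp only [centroidIndices, parallelIndices, Finset.mem_filter, Finset.mem_univ, true_and]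
  constructor
  · intro h
    have hj : IsSignedProj (projBasis H.1 j) := ⟨projBasis_ne_zero hk H hH j, j, Or.inl rfl⟩
    have hmem : centroid (faceOf v) ∈ line (projBasis H.1 j) := by
      have : centroid (faceOf v) ∈ line (projBasis H.1 j) ∩ faceOf v := by rw [h]; rfl
      exact this.1
    obtain ⟨a, ha⟩ := mem_line.1 hmem
    set u := projBasis H.1 j
    have hu0 := norm_pos_iff.2 hj.1
    have hv0 := norm_pos_iff.2 hv.1
    have h1 := hj.abs_inner_le_one (centroid_mem_faceOf hk hH hv).1
    have h2 := hv.abs_inner_le_one (centroid_mem_faceOf hk hH hj).1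
    rw [centroid_faceOf hk hH hv] at ha h1
    rw [centroid_faceOf hk hH hj] at h2
    have hva : v = (‖v‖ ^ 2 * a) • u := by
      rw [mul_smul, ha, smul_inv_smul₀ (by positivity)]
    set b := ‖v‖ ^ 2 * a
    have hb0 : b ≠ 0 := fun hb => hv.1 (by rw [hva, hb, zero_smul])
    have hnv : ‖v‖ ^ 2 = b ^ 2 * ‖u‖ ^ 2 := by
      rw [hva, norm_smul, mul_pow, Real.norm_eq_abs, sq_abs]
    have huv : ⟪u, v⟫_ℝ = b * ‖u‖ ^ 2 := by
      rw [hva, submodule_inner_smul_right, real_inner_self_eq_norm_sq]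
    rw [submodule_inner_smul_left, real_inner_comm, huv, hnv] at h1
    rw [submodule_inner_smul_left, huv] at h2
    have e1 : (b ^ 2 * ‖u‖ ^ 2)⁻¹ * (b * ‖u‖ ^ 2) = b⁻¹ := by field_simp
    have e2 : (‖u‖ ^ 2)⁻¹ * (b * ‖u‖ ^ 2) = b := by field_simp
    rw [e1, abs_inv, inv_le_one₀ (abs_pos.2 hb0)] at h1
    rw [e2] at h2
    rcases abs_eq (zero_le_one' ℝ) |>.1 (le_antisymm h2 h1) with hb | hb
    · left; rw [hva, hb, one_smul]
    · right; rw [hva, hb, neg_one_smul, neg_neg]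
  · rintro (h | h)
    · rw [h]; exact line_inter_faceOf hk hH hv
    · rw [h, line_neg]; exact line_inter_faceOf hk hH hv

lemma centroid_mem_frontier (hk : 2 ≤ k) (hH : IsLocalMax (sectionVolume n k) H) {v : H.1}
    (hv : IsSignedProj v) : centroid (faceOf v) ∈ frontier (cubeSection H.1) := by
  obtain ⟨hc, hc1⟩ := centroid_mem_faceOf hk hH hv
  set c := centroid (faceOf v)
  have hc1 : ⟪c, v⟫_ℝ = 1 := hc1
  refine ⟨subset_closure hc, fun hint => ?_⟩
  have hcont : Continuous fun t : ℝ => t • c := by fun_prop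
  -- An interior point could be pushed outwards along its ray, violating `⟪x, v⟫ ≤ 1`.
  have hev : ∀ᶠ t in 𝓝 (1 : ℝ), t • c ∈ cubeSection H.1 := by
    apply hcont.continuousAt.eventually_mem
    rw [one_smul]
    exact mem_interior_iff_mem_nhds.1 hint
  obtain ⟨t, ht, ht1⟩ := ((hev.filter_mono nhdsWithin_le_nhds).and
    (self_mem_nhdsWithin (s := Set.Ioi 1))).exists
  have h := (le_abs_self _).trans (hv.abs_inner_le_one ht)
  rw [submodule_inner_smul_left, hc1, mul_one] at h
  exact not_lt.2 h ht1

lemma eq_centroid_of_mem_line_frontier (hk : 2 ≤ k) (hH : IsLocalMax (sectionVolume n k) H)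
    {v : H.1} (hv : IsSignedProj v) {x : H.1} (hx : x ∈ line v)
    (hxf : x ∈ frontier (cubeSection H.1)) :
    x = centroid (faceOf v) ∨ x = centroid (faceOf (-v)) := by
  have hv0 := norm_pos_iff.2 hv.1
  have hxP : x ∈ cubeSection H.1 := (isCompact_cubeSection H.1).isClosed.frontier_subset hxf
  have hc := (centroid_mem_faceOf hk hH hv).1
  rw [centroid_faceOf hk hH hv] at hc ⊢
  rw [centroid_faceOf hk hH hv.neg, norm_neg, smul_neg]
  set c := (‖v‖ ^ 2)⁻¹ • v
  obtain ⟨a, rfl⟩ := mem_line.1 hx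
  have hac : a • v = (a * ‖v‖ ^ 2) • c := by rw [mul_smul, smul_inv_smul₀ (by positivity)]
  have h1 := hv.abs_inner_le_one hxP
  rw [submodule_inner_smul_left, real_inner_self_eq_norm_sq] at h1
  rw [hac] at hxf ⊢
  -- The point is `r • c` with `c` the centroid and `|r| ≤ 1`. If `|r| < 1` its maximal coordinate
  -- is below `1`, so it is interior; hence `r = ± 1`.
  rcases h1.lt_or_eq with h | h
  · exfalso
    refine hxf.2 (mem_interior.2 ⟨{y | supCoord (y : EuclideanSpace ℝ (Fin n)) < 1},
      fun y hy => mem_cubeSection_iff_supCoord.2 (le_of_lt hy), ?_, ?_⟩)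
    · exact isOpen_lt (continuous_supCoord.comp continuous_subtype_val) continuous_const
    · change supCoord _ < 1
      rw [Submodule.coe_smul, supCoord_smul]
      exact mul_lt_one_of_nonneg_of_lt_one_left (abs_nonneg _) h
        (mem_cubeSection_iff_supCoord.1 hc)
  · rcases abs_eq (zero_le_one' ℝ) |>.1 h with h | h
    · left; rw [h, one_smul]
    · right; rw [h, neg_one_smul]

end LocalMax

end CubeSection

/-! ### The theorem -/

open CubeSection in
theorem theorem1p1 (n k : ℕ) (hk : 2 ≤ k) (H : Gr n k)
    (hH : IsLocalMax (sectionVolume n k) H) :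
    (cubeSection H.1 = ⋂ i : Fin n, {x : H.1 | |inner ℝ x (projBasis H.1 i)| ≤ 1}) ∧
    (∀ i : Fin n, projBasis H.1 i ≠ 0 ∧ IsFacet (cubeSection H.1) (facetAt H.1 i)) ∧
    (∀ i : Fin n,
      line (projBasis H.1 i) ∩ facetAt H.1 i = {centroid (facetAt H.1 i)} ∧
      (line (projBasis H.1 i) ∩ frontier (cubeSection H.1)).Nonempty ∧
      ∀ x ∈ line (projBasis H.1 i) ∩ frontier (cubeSection H.1),
        ∃ F : Set H.1, IsFacet (cubeSection H.1) F ∧ x = centroid F) ∧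
    (∀ F : Set H.1, IsFacet (cubeSection H.1) F →
      vol k (convexHull ℝ (insert 0 F)) / vol k (cubeSection H.1) =
        1 / 2 * ((∑ i ∈ centroidIndices H.1 F, ‖projBasis H.1 i‖ ^ 2) / k)) := by
  have hproj : ∀ i, IsSignedProj (projBasis H.1 i) := fun i =>
    ⟨projBasis_ne_zero hk H hH i, i, Or.inl rfl⟩
  refine ⟨?_, fun i => ⟨(hproj i).1, isFacet_faceOf hk hH (hproj i)⟩, fun i => ⟨?_, ?_, ?_⟩, ?_⟩
  · ext x
    rw [mem_cubeSection, Set.mem_iInter]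
    rfl
  · exact line_inter_faceOf hk hH (hproj i)
  · refine ⟨centroid (faceOf (projBasis H.1 i)), ?_, centroid_mem_frontier hk hH (hproj i)⟩
    have h : centroid (faceOf (projBasis H.1 i)) ∈
        line (projBasis H.1 i) ∩ faceOf (projBasis H.1 i) := by
      rw [line_inter_faceOf hk hH (hproj i)]; rfl
    exact h.1
  · rintro x ⟨hx, hxf⟩
    rcases eq_centroid_of_mem_line_frontier hk hH (hproj i) hx hxf with h | h
    · exact ⟨_, isFacet_faceOf hk hH (hproj i), h⟩
    · exact ⟨_, isFacet_faceOf hk hH (hproj i).neg, h⟩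
  · intro F hF
    obtain ⟨v, hv, rfl⟩ := exists_eq_faceOf hk hH hF
    have hsum : ∑ i ∈ parallelIndices v, ‖projBasis H.1 i‖ ^ 2 =
        (parallelIndices v).card * ‖v‖ ^ 2 := by
      rw [Finset.sum_congr rfl (g := fun _ => ‖v‖ ^ 2), Finset.sum_const, nsmul_eq_mul]
      intro i hi
      simp only [parallelIndices, Finset.mem_filter, Finset.mem_univ, true_and] at hi
      rcases hi with h | h
      · rw [h]
      · rw [h, norm_neg]
    rw [centroidIndices_faceOf hk hH hv, hsum, vol_convexHull_insert_zero hk hH hv,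
      mul_div_cancel_right₀ _ (vol_cubeSection_pos H).ne']
    ring
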